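/- Let $q,t$ be indeterminates, $\mathbb{F}=\mathbb{C}(q,t)$, let $\mathbb{Y}$ be the set of all partitions (including $\emptyset$), and let $\Lambda$ be the ring of symmetric functions over $\mathbb{F}$ with monomial symmetric functions $m_\lambda$, power sums $p_n$, $p_\lambda=p_{\lambda_1}p_{\lambda_2}\cdots$, and the bilinear form $$\langle p_\lambda,p_\mu\rangle_{q,t}=\delta_{\lambda,\mu}\prod_{i\ge1} m_i(\lambda)!\,i^{m_i(\lambda)}\prod_{i=1}^{\ell(\lambda)}\frac{1-q^{\lambda_i}}{1-t^{\lambda_i}},$$ where $m_i(\lambda)$ is the multiplicity of $i$ in $\lambda$. Let $P_\lambda\in\Lambda$ be the Macdonald symmetric functions, characterized by $P_\lambda\in m_\lambda+\sum_{\mu<\lambda}\mathbb{F}m_\mu$ (dominance order) and $\langle P_\lambda,P_\mu\rangle_{q,t}=0$ for $\lambda\ne\mu$, and let $Q_\lambda=P_\lambda/\langle P_\lambda,P_\lambda\rangle_{q,t}$. The skew functions are defined by $P_\lambda(X,Y)=\sum_\mu P_{\lambda/\mu}(X)P_\mu(Y)$ and $Q_\lambda(X,Y)=\sum_\mu Q_{\lambda/\mu}(X)Q_\mu(Y)$.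 Put $\Pi(X,Y)=\sum_{\lambda}P_\lambda(X)Q_\lambda(Y)$ and $\Psi_{\lambda,\mu}(Y,X)=\sum_{\nu}Q_{\lambda/\nu}(Y)P_{\mu/\nu}(X)$. Let $N\ge1$ and let $X^{(1)},\dots,X^{(N)},Y^{(1)},\dots,Y^{(N)}$ be $2N$ disjoint countably infinite sets of variables. The $N$-step Macdonald process assigns to $(\lambda^{(1)},\dots,\lambda^{(N)})\in\mathbb{Y}^N$ the formal power series $$\mathbb{MP}^N_{q,t}(\lambda^{(1)},\dots,\lambda^{(N)})=\frac{P_{\lambda^{(1)}}(X^{(1)})\Psi_{\lambda^{(1)},\lambda^{(2)}}(Y^{(1)},X^{(2)})\cdots\Psi_{\lambda^{(N-1)},\lambda^{(N)}}(Y^{(N-1)},X^{(N)})Q_{\lambda^{(N)}}(Y^{(N)})}{\prod_{1\le i\le j\le N}\Pi(X^{(i)},Y^{(j)})}$$ over $\mathbb{F}$, and the correlation function of $f_1,\dots,f_N:\mathbb{Y}\to\mathbb{F}$ is $$\mathbb{E}^N_{q,t}[f_1[1]\cdots f_N[N]]=\sum_{(\lambda^{(1)},\dots,\lambda^{(N)})\in\mathbb{Y}^N}f_1(\lambda^{(1)})\cdots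 f_N(\lambda^{(N)})\,\mathbb{MP}^N_{q,t}(\lambda^{(1)},\dots,\lambda^{(N)}).$$ Let $\mathcal{F}=\mathbb{F}[a_{-1},a_{-2},\dots]|0\rangle$ and $\mathcal{F}^\dagger=\langle0|\mathbb{F}[a_1,a_2,\dots]$ be the Fock space and the dual Fock space of the Heisenberg algebra $[a_m,a_n]=m\frac{1-q^{|m|}}{1-t^{|m|}}\delta_{m+n,0}$ ($m,n\in\mathbb{Z}\setminus\{0\}$), where $a_n|0\rangle=0$ and $\langle0|a_{-n}=0$ for $n>0$, with the invariant pairing normalized by $\langle0|0\rangle=1$. Identify $\mathcal{F}$ and $\mathcal{F}^\dagger$ with $\Lambda$ by $a_{-\lambda_1}a_{-\lambda_2}\cdots|0\rangle\mapsto p_\lambda$ and $\langle0|a_{\lambda_1}a_{\lambda_2}\cdots\mapsto p_\lambda$, and let $|P_\lambda\rangle\in\mathcal{F}$ and $\langle Q_\lambda|\in\mathcal{F}^\dagger$ correspond to $P_\lambda$ and $Q_\lambda$. For $f:\mathbb{Y}\to\mathbb{F}$ and sets of variables $X,Y$ put $$\Gamma(X)_\pm=\exp\Big(\sum_{n>0}\frac{1-t^n}{1-q^n}\frac{p_n(X)}{n}a_{\pm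 n}\Big),\qquad \mathcal{O}(f)=\sum_{\lambda\in\mathbb{Y}}f(\lambda)|P_\lambda\rangle\langle Q_\lambda|,\qquad \psi_f^{X,Y}=\Gamma(Y)_+\,\mathcal{O}(f)\,\Gamma(X)_-,$$ regarded as formal power series in the variables with coefficients in $\mathrm{End}(\mathcal{F})$. Then for all $f_1,\dots,f_N:\mathbb{Y}\to\mathbb{F}$ $$\mathbb{E}^N_{q,t}[f_1[1]\cdots f_N[N]]=\frac{\langle0|\psi_{f_N}^{X^{(N)},Y^{(N)}}\cdots\psi_{f_1}^{X^{(1)},Y^{(1)}}|0\rangle}{\langle0|\psi_{1}^{X^{(N)},Y^{(N)}}\cdots\psi_{1}^{X^{(1)},Y^{(1)}}|0\rangle}$$ as formal power series over $\mathbb{F}$ in the variables $X^{(1)},\dots,X^{(N)},Y^{(1)},\dots,Y^{(N)}$, where $1$ is the constant function. Here the series defining $\Pi(X^{(i)},Y^{(j)})$ ($i\le j$), the transition functions in the process and the correlation function converge formally (each monomial has a nonzero coefficient in only finitely many terms), and both denominators, $\prod_{i\le j}\Pi(X^{(i)},Y^{(j)})$ and the one on the right, are invertible power series. -/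

import Mathlib

namespace MacFock

noncomputable section

open MvPowerSeries

/-- A partition, given by the finite multiset of its (positive) parts; `l.count i` is the
multiplicity of the part `i`, and `0` is the empty partition. -/
abbrev Ptn : Type := Multiset ℕ+

namespace Ptn
/-- The weight `|l|`, the sum of the parts. -/
def weight (l : Ptn) : ℕ := (l.map (fun k : ℕ+ => (k : ℕ))).sum

/-- The sum of the `n` largest parts, `l_1 + ... + l_n`. -/
def partialSum (l : Ptn) (n : ℕ) : ℕ :=
  (((l.map (fun k : ℕ+ => (k : ℕ))).sort (· ≥ ·)).take n).sum

/-- `m ≤ l` in the dominance order. -/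
def DominatedBy (m l : Ptn) : Prop :=
  m.weight = l.weight ∧ ∀ n : ℕ, m.partialSum n ≤ l.partialSum n
end Ptn

/-- The partition formed by the nonzero exponents of the monomial `x^e`. -/
def shape (e : ℕ →₀ ℕ) : Ptn := e.support.val.map fun i => (e i).toPNat'

section
variable (K : Type) [Field K]

/-- The ring of symmetric functions: power series in `x_0, x_1, ...` of bounded degree that are
invariant under all permutations of the variables. -/
def SymFun : Subalgebra K (MvPowerSeries ℕ K) where
  carrier := {f | (∀ s : Equiv.Perm ℕ, rename s f = f) ∧
    ∃ d : ℕ, ∀ e : ℕ →₀ ℕ, coeff e f ≠ 0 → e.degree ≤ d}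
  mul_mem' := by
    rintro f g ⟨hf, d, hd⟩ ⟨hg, d', hd'⟩
    refine ⟨fun s => by rw [map_mul, hf, hg], d + d', fun e he => ?_⟩
    classical
    rw [coeff_mul] at he
    obtain ⟨x, hx, hne⟩ := Finset.exists_ne_zero_of_sum_ne_zero he
    have h1 := hd _ (left_ne_zero_of_mul hne)
    have h2 := hd' _ (right_ne_zero_of_mul hne)
    rw [← Finset.HasAntidiagonal.mem_antidiagonal.1 hx, map_add]
    omega
  add_mem' := by
    rintro f g ⟨hf, d, hd⟩ ⟨hg, d', hd'⟩
    refine ⟨fun s => by rw [map_add, hf, hg], max d d', fun e he => ?_⟩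
    by_contra hlt
    rw [not_le, max_lt_iff] at hlt
    refine he ?_
    rw [map_add, not_not.1 (mt (hd e) (not_le.2 hlt.1)),
      not_not.1 (mt (hd' e) (not_le.2 hlt.2)), add_zero]
  algebraMap_mem' := by
    intro r
    refine ⟨fun s => AlgHom.commutes _ r, 0, fun e he => ?_⟩
    classical
    rw [← c_eq_algebraMap, coeff_C] at he
    by_cases h : e = 0
    · simp [h]
    · simp [h] at he

variable {K}

theorem coeff_perm (f : MvPowerSeries ℕ K) (s : Equiv.Perm ℕ) (e : ℕ →₀ ℕ) :
    coeff (e.mapDomain s) (rename s f) = coeff e f := by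
  have := coeff_embDomain_rename s.toEmbedding f e
  rw [Finsupp.embDomain_eq_mapDomain] at this
  exact this

theorem shape_mapDomain (s : Equiv.Perm ℕ) (e : ℕ →₀ ℕ) : shape (e.mapDomain s) = shape e := by
  have h1 : e.mapDomain s = e.embDomain s.toEmbedding := by
    rw [Finsupp.embDomain_eq_mapDomain]; rfl
  rw [h1, shape, shape, Finsupp.support_embDomain, Finset.map_val, Multiset.map_map]
  refine Multiset.map_congr rfl fun i _ => ?_
  exact congrArg Nat.toPNat' (Finsupp.embDomain_apply_self s.toEmbedding e i)

theorem exists_perm_of_shape_eq {e e' : ℕ →₀ ℕ} (h : shape e = shape e') :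
    ∃ s : Equiv.Perm ℕ, e.mapDomain s = e' := by
  classical
  have key : ∀ c : ℕ, Nonempty ({i // e i = c} ≃ {i // e' i = c}) := by
    intro c
    rcases Nat.eq_zero_or_pos c with rfl | hc
    · have inf : ∀ g : ℕ →₀ ℕ, Infinite {i // g i = 0} := fun g => by
        have : {i | g i = 0} = ((g.support : Set ℕ))ᶜ := by ext; simp
        change Infinite ↥{i | g i = 0}
        rw [this]
        exact (g.support.finite_toSet.infinite_compl).to_subtype
      have := inf e
      have := inf e'
      exact nonempty_equiv_of_countable
    · have cnt : ∀ g : ℕ →₀ ℕ, Multiset.count c.toPNat' (shape g) =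
          (g.support.filter fun i => g i = c).card := fun g => by
        rw [shape, Multiset.count_map, ← Finset.filter_val, Finset.card_val]
        congr 1
        refine Finset.filter_congr fun i hi => ?_
        rw [← PNat.coe_inj, PNat.toPNat'_coe hc,
          PNat.toPNat'_coe (Nat.pos_of_ne_zero (Finsupp.mem_support_iff.1 hi)), eq_comm]
      have eqv : ∀ g : ℕ →₀ ℕ, Nonempty ({i // g i = c} ≃ (g.support.filter fun i => g i = c)) :=
        fun g => ⟨Equiv.subtypeEquivRight fun i => by simp; omega⟩
      have h3 := cnt e
      rw [h, cnt e'] at h3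
      exact ⟨(eqv e).some.trans ((Finset.equivOfCardEq h3.symm).trans (eqv e').some.symm)⟩
  let s : Equiv.Perm ℕ := Equiv.ofFiberEquiv fun c => (key c).some
  have hs : ∀ i, e' (s i) = e i := fun i => Equiv.ofFiberEquiv_map _ i
  refine ⟨s, ?_⟩
  ext j
  obtain ⟨i, rfl⟩ := s.surjective j
  rw [Finsupp.mapDomain_apply s.injective, hs]

theorem coeff_eq_of_shape_eq {f : MvPowerSeries ℕ K} (hf : f ∈ SymFun K) {e e' : ℕ →₀ ℕ}
    (h : shape e = shape e') : coeff e f = coeff e' f := by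
  obtain ⟨s, rfl⟩ := exists_perm_of_shape_eq h
  rw [← coeff_perm f s e, hf.1 s]

theorem mem_symFun_of {f : MvPowerSeries ℕ K}
    (h : ∀ (s : Equiv.Perm ℕ) (e : ℕ →₀ ℕ), coeff (e.mapDomain s) f = coeff e f)
    (d : ℕ) (hd : ∀ e : ℕ →₀ ℕ, coeff e f ≠ 0 → e.degree ≤ d) : f ∈ SymFun K := by
  refine ⟨fun s => ?_, d, hd⟩
  ext e
  obtain ⟨e, rfl⟩ : ∃ e₀ : ℕ →₀ ℕ, e = e₀.mapDomain s :=
    ⟨e.mapDomain s.symm, by rw [← Finsupp.mapDomain_comp]; simp⟩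
  rw [coeff_perm, h]

theorem weight_shape (e : ℕ →₀ ℕ) : (shape e).weight = e.degree := by
  rw [Ptn.weight, shape, Multiset.map_map, Finsupp.degree_apply, Finset.sum]
  congr 1
  refine Multiset.map_congr rfl fun i hi => ?_
  simp only [Function.comp]
  exact PNat.toPNat'_coe (Nat.pos_of_ne_zero (Finsupp.mem_support_iff.1 hi))

variable (K) in
/-- The monomial symmetric function `m_l`: the sum of all distinct monomials of shape `l`. -/
def msymm (l : Ptn) : SymFun K :=
  ⟨fun e => if shape e = l then 1 else 0, mem_symFun_of
    (fun s e => by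
      change (if shape (e.mapDomain s) = l then (1 : K) else 0) = if shape e = l then 1 else 0
      rw [shape_mapDomain]) l.weight
    (fun e he => by
      have : (if shape e = l then (1 : K) else 0) ≠ 0 := he
      rw [← weight_shape, (ite_ne_right_iff.1 this).1])⟩

theorem coeff_msymm (l : Ptn) (e : ℕ →₀ ℕ) :
    coeff e (msymm K l : MvPowerSeries ℕ K) = if shape e = l then 1 else 0 := rfl

theorem shape_single (i : ℕ) (n : ℕ+) : shape (Finsupp.single i (n : ℕ)) = {n} := by
  rw [shape, Finsupp.support_single _ n.ne_zero]
  simp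

theorem shape_eq_singleton {e : ℕ →₀ ℕ} {n : ℕ+} :
    shape e = {n} ↔ ∃ i, e = Finsupp.single i (n : ℕ) := by
  constructor
  · intro h
    obtain ⟨s, hs⟩ := exists_perm_of_shape_eq ((shape_single 0 n).trans h.symm)
    exact ⟨s 0, by rw [← hs, Finsupp.mapDomain_single]⟩
  · rintro ⟨i, rfl⟩
    exact shape_single i n

open Classical in
variable (K) in
/-- The power sum `p_n = ∑ i, x_i ^ n`. -/
def psum (n : ℕ+) : SymFun K :=
  ⟨fun e => if ∃ i, e = Finsupp.single i (n : ℕ) then 1 else 0, by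
    have h : (fun e : ℕ →₀ ℕ => if ∃ i, e = Finsupp.single i (n : ℕ) then (1 : K) else 0) =
        fun e => if shape e = {n} then 1 else 0 := by
      funext e
      simp only [shape_eq_singleton]
    rw [h]
    exact (msymm K {n}).2⟩

theorem coeff_psum (n : ℕ+) (e : ℕ →₀ ℕ) :
    coeff e (psum K n : MvPowerSeries ℕ K) = if shape e = {n} then 1 else 0 := by
  classical
  change (if ∃ i, e = Finsupp.single i (n : ℕ) then (1 : K) else 0) = _
  simp only [shape_eq_singleton]

theorem card_shape (e : ℕ →₀ ℕ) : (shape e).card = e.support.card := by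
  rw [shape, Multiset.card_map, Finset.card_val]

theorem shape_single_add {e : ℕ →₀ ℕ} {i : ℕ} (n : ℕ+) (hi : e i = 0) :
    shape (Finsupp.single i (n : ℕ) + e) = n ::ₘ shape e := by
  classical
  have hs : (Finsupp.single i (n : ℕ) + e).support = insert i e.support := by
    ext j
    by_cases h : i = j
    · subst h; simp
    · simp [Ne.symm h]
  have hi' : i ∉ e.support := by simpa using hi
  rw [shape, hs, Finset.insert_val_of_notMem hi', Multiset.map_cons]
  congr 1
  · simp [hi]
  · refine Multiset.map_congr rfl fun j hj => ?_
    have : i ≠ j := fun h => hi' (h ▸ hj)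
    simp [this]

theorem card_support_single_add {e : ℕ →₀ ℕ} {i : ℕ} (n : ℕ+) (hi : e i ≠ 0) :
    (shape (Finsupp.single i (n : ℕ) + e)).card = (shape e).card := by
  rw [card_shape, card_shape]
  congr 1
  ext j
  by_cases h : i = j
  · subst h; simp [hi]
  · simp [h]

theorem exists_of_shape_eq_cons {e : ℕ →₀ ℕ} {n : ℕ+} {l : Ptn} (h : shape e = n ::ₘ l) :
    ∃ (i : ℕ) (e' : ℕ →₀ ℕ), e = Finsupp.single i (n : ℕ) + e' ∧ shape e' = l := by
  have hn : n ∈ shape e := by rw [h]; exact Multiset.mem_cons_self n l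
  obtain ⟨i, hi, hin⟩ := Multiset.mem_map.1 hn
  have hi' : e i ≠ 0 := Finsupp.mem_support_iff.1 hi
  have hv : (n : ℕ) = e i := by rw [← hin, PNat.toPNat'_coe (Nat.pos_of_ne_zero hi')]
  have he : e = Finsupp.single i (n : ℕ) + e.erase i := by
    rw [hv, Finsupp.single_add_erase]
  refine ⟨i, e.erase i, he, ?_⟩
  rw [he, shape_single_add n (by simp)] at h
  exact Multiset.cons_inj_right n |>.1 h

theorem shape_surjective (l : Ptn) : ∃ e : ℕ →₀ ℕ, shape e = l := by
  induction l using Multiset.induction with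
  | empty => exact ⟨0, rfl⟩
  | cons n l ih =>
    obtain ⟨e, he⟩ := ih
    obtain ⟨i, hi⟩ := e.support.exists_notMem
    exact ⟨Finsupp.single i (n : ℕ) + e, by
      rw [shape_single_add n (by simpa using hi), he]⟩

/-- Some exponent vector of shape `l`. -/
def canon (l : Ptn) : ℕ →₀ ℕ := (shape_surjective l).choose

theorem shape_canon (l : Ptn) : shape (canon l) = l := (shape_surjective l).choose_spec

theorem finite_weight_le (d : ℕ) : {l : Ptn | l.weight ≤ d}.Finite := by
  refine (Set.finite_Iic (d • (Finset.Icc 1 d.succPNat).val)).subset fun l hl => ?_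
  change l ≤ _
  have hle : ∀ k : ℕ+, l.count k * (k : ℕ) ≤ Ptn.weight l := fun k => by
    have h1 : Multiset.replicate (l.count k) k ≤ l := Multiset.le_count_iff_replicate_le.1 le_rfl
    obtain ⟨u, hu⟩ := Multiset.le_iff_exists_add.1 h1
    have h2 : Ptn.weight l = l.count k * (k : ℕ) + (u.map (fun k : ℕ+ => (k : ℕ))).sum := by
      conv_lhs => rw [hu]
      simp [Ptn.weight]
    omega
  rw [Multiset.le_iff_count]
  intro k
  by_cases hk : l.count k = 0
  · simp [hk]
  have h3 := (hle k).trans hl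
  have hk1 : 1 ≤ l.count k := Nat.one_le_iff_ne_zero.2 hk
  have hkd : (k : ℕ) ≤ d := le_trans (Nat.le_mul_of_pos_left _ hk1) h3
  have hmem : k ∈ (Finset.Icc 1 d.succPNat).val := by
    rw [Finset.mem_val, Finset.mem_Icc, ← PNat.coe_le_coe k, Nat.succPNat_coe]
    exact ⟨one_le, by omega⟩
  rw [Multiset.count_nsmul, Multiset.count_eq_one_of_mem (Finset.nodup _) hmem, mul_one]
  exact le_trans (Nat.le_mul_of_pos_right _ k.pos) h3

theorem expand_msymm (f : SymFun K) : ∃ T : Finset Ptn,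
    (∀ l ∈ T, coeff (canon l) (f : MvPowerSeries ℕ K) ≠ 0) ∧
    f = ∑ l ∈ T, coeff (canon l) (f : MvPowerSeries ℕ K) • msymm K l := by
  classical
  obtain ⟨d, hd⟩ := f.2.2
  have hfin : {l : Ptn | coeff (canon l) (f : MvPowerSeries ℕ K) ≠ 0}.Finite := by
    refine (finite_weight_le d).subset fun l hl => ?_
    have := hd _ hl
    rwa [← weight_shape, shape_canon] at this
  refine ⟨hfin.toFinset, fun l hl => by simpa using hl, ?_⟩
  apply Subtype.ext
  ext e
  rw [AddSubmonoidClass.coe_finsetSum, map_sum]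
  have hc : coeff (canon (shape e)) (f : MvPowerSeries ℕ K) = coeff e (f : MvPowerSeries ℕ K) :=
    coeff_eq_of_shape_eq f.2 (shape_canon _)
  rw [Finset.sum_eq_single (shape e)]
  · simp [coeff_msymm, hc]
  · intro l _ hl
    simp [coeff_msymm, Ne.symm hl]
  · intro h
    have : coeff (canon (shape e)) (f : MvPowerSeries ℕ K) = 0 := by simpa using h
    rw [this, zero_smul]
    simp

variable (K) in
/-- `p_l = p_{l_1} p_{l_2} ...`. -/
def psumPtn (l : Ptn) : SymFun K := (l.map (psum K)).prod

theorem coeff_psumPtn (l : Ptn) : ∀ e : ℕ →₀ ℕ, ∃ k : ℕ,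
    coeff e (psumPtn K l : MvPowerSeries ℕ K) = k ∧
    (k ≠ 0 → (shape e).card ≤ l.card ∧ ((shape e).card = l.card → shape e = l)) ∧
    (shape e = l → k ≠ 0) := by
  classical
  induction l using Multiset.induction with
  | empty =>
    intro e
    refine ⟨if e = 0 then 1 else 0, ?_, ?_, ?_⟩
    · simp [psumPtn, coeff_one]
    · intro h
      have : e = 0 := by simpa using h
      subst this
      exact ⟨by simp [shape], fun _ => rfl⟩
    · intro h
      have := card_shape e
      rw [h] at this
      have h0 : e = 0 := Finsupp.card_support_eq_zero.1 this.symm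
      simp [h0]
  | cons n l ih =>
    choose k hk1 hk2 hk3 using ih
    intro e
    refine ⟨∑ x ∈ Finset.HasAntidiagonal.antidiagonal e, (if shape x.1 = {n} then 1 else 0) * k x.2, ?_, ?_, ?_⟩
    · have : (psumPtn K (n ::ₘ l) : MvPowerSeries ℕ K) = psum K n * psumPtn K l := by
        simp [psumPtn]
      rw [this, coeff_mul, Nat.cast_sum]
      refine Finset.sum_congr rfl fun x _ => ?_
      rw [coeff_psum, hk1]
      split_ifs <;> simp
    · intro h
      obtain ⟨x, hx, hne⟩ := Finset.exists_ne_zero_of_sum_ne_zero h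
      obtain ⟨h1, _⟩ := ite_ne_right_iff.1 (left_ne_zero_of_mul hne)
      obtain ⟨i, hi⟩ := shape_eq_singleton.1 h1
      obtain ⟨h4, h5⟩ := hk2 _ (right_ne_zero_of_mul hne)
      have he : e = Finsupp.single i (n : ℕ) + x.2 := by
        rw [← hi, Finset.HasAntidiagonal.mem_antidiagonal.1 hx]
      rw [he, Multiset.card_cons]
      by_cases h0 : x.2 i = 0
      · rw [shape_single_add n h0, Multiset.card_cons]
        exact ⟨by omega, fun h => by rw [h5 (by omega)]⟩
      · rw [card_support_single_add n h0]
        exact ⟨by omega, fun h => by omega⟩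
    · intro h
      obtain ⟨i, e', he, hl⟩ := exists_of_shape_eq_cons h
      refine ne_of_gt (Nat.lt_of_lt_of_le (Nat.pos_of_ne_zero (hk3 e' hl)) ?_)
      have := Finset.single_le_sum (s := Finset.HasAntidiagonal.antidiagonal e)
        (f := fun x => (if shape x.1 = {n} then 1 else 0) * k x.2)
        (fun _ _ => Nat.zero_le _)
        (Finset.HasAntidiagonal.mem_antidiagonal.2 he.symm : (Finsupp.single i (n : ℕ), e') ∈ _)
      simpa [shape_single] using this

theorem psumPtn_linearIndependent [CharZero K] : LinearIndependent K (psumPtn K) := by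
  classical
  rw [linearIndependent_iff']
  intro s g hg
  by_contra! hne
  obtain ⟨l₀, hl₀, hne₀⟩ := hne
  obtain ⟨l, hl, hmax⟩ := Finset.exists_max_image (s.filter fun l => g l ≠ 0)
    (fun l => l.card) ⟨l₀, by simp [hl₀, hne₀]⟩
  rw [Finset.mem_filter] at hl
  have h1 := congrArg (fun f : SymFun K => coeff (canon l) (f : MvPowerSeries ℕ K)) hg
  simp only [AddSubmonoidClass.coe_finsetSum, map_sum] at h1
  rw [Finset.sum_eq_single l] at h1
  · obtain ⟨k, hk1, _, hk3⟩ := coeff_psumPtn (K := K) l (canon l)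
    have := hk3 (shape_canon l)
    simp [hk1, hl.2, this] at h1
  · intro b hb hbl
    obtain ⟨k, hk1, hk2, _⟩ := coeff_psumPtn (K := K) b (canon l)
    by_cases hgb : g b = 0
    · simp [hgb]
    · have hc := hmax b (by simp [hb, hgb])
      have : k = 0 := by
        by_contra hk
        obtain ⟨h2, h3⟩ := hk2 hk
        rw [shape_canon] at h2 h3
        exact hbl (h3 (le_antisymm h2 hc)).symm
      simp [hk1, this]
  · exact fun h => absurd hl.1 h

theorem msymm_mem_span [CharZero K] (l : Ptn) :
    msymm K l ∈ Submodule.span K (Set.range (psumPtn K)) := by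
  classical
  induction hn : l.card using Nat.strong_induction_on generalizing l with
  | _ n ih =>
    obtain ⟨T, hT, hf⟩ := expand_msymm (psumPtn K l)
    obtain ⟨k, hk1, _, hk3⟩ := coeff_psumPtn (K := K) l (canon l)
    have hk := hk3 (shape_canon l)
    have hlT : (k : K) • msymm K l =
        psumPtn K l - ∑ m ∈ T.erase l, coeff (canon m) (psumPtn K l : MvPowerSeries ℕ K) •
          msymm K m := by
      rw [eq_sub_iff_add_eq, ← hk1]
      by_cases hl : l ∈ T
      · conv_rhs => rw [hf]
        exact Finset.add_sum_erase T
          (fun m => coeff (canon m) (psumPtn K l : MvPowerSeries ℕ K) • msymm K m) hl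
      · exfalso
        have h2 := congrArg (fun f : SymFun K => coeff (canon l) (f : MvPowerSeries ℕ K)) hf
        simp only [AddSubmonoidClass.coe_finsetSum, map_sum] at h2
        rw [Finset.sum_eq_zero, hk1] at h2
        · exact hk (by exact_mod_cast h2)
        · intro m hm
          have : l ≠ m := fun h => hl (h ▸ hm)
          simp [coeff_msymm, shape_canon, this]
    have hmem : (k : K) • msymm K l ∈ Submodule.span K (Set.range (psumPtn K)) := by
      rw [hlT]
      refine sub_mem (Submodule.subset_span ⟨l, rfl⟩) (sum_mem fun m hm => ?_)
      rw [Finset.mem_erase] at hm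
      refine Submodule.smul_mem _ _ (ih m.card ?_ m rfl)
      obtain ⟨k', hk1', hk2', _⟩ := coeff_psumPtn (K := K) l (canon m)
      have hne := hT m hm.2
      rw [hk1'] at hne
      obtain ⟨h3, h4⟩ := hk2' (by exact_mod_cast hne)
      rw [shape_canon] at h3 h4
      exact hn ▸ lt_of_le_of_ne h3 fun h => hm.1 (h4 h)
    have hk0 : (k : K) ≠ 0 := by exact_mod_cast hk
    simpa [smul_smul, hk0] using Submodule.smul_mem _ (k : K)⁻¹ hmem

variable (K) in
/-- The basis `(p_l)` of the ring of symmetric functions. -/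
def psumBasis [CharZero K] : Module.Basis Ptn K (SymFun K) :=
  Module.Basis.mk psumPtn_linearIndependent (by
    intro f _
    obtain ⟨T, _, hf⟩ := expand_msymm f
    rw [hf]
    exact sum_mem fun l _ => Submodule.smul_mem _ _ (msymm_mem_span l))

theorem psumBasis_apply [CharZero K] (l : Ptn) : psumBasis K l = psumPtn K l := by
  rw [psumBasis, Module.Basis.mk_apply]

end

/-- The field `ℂ(q, t)` of rational functions in two indeterminates. -/
abbrev QT : Type := FractionRing (MvPolynomial (Fin 2) ℂ)

/-- The indeterminate `q`. -/
def q : QT := algebraMap (MvPolynomial (Fin 2) ℂ) QT (MvPolynomial.X 0)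

/-- The indeterminate `t`. -/
def t : QT := algebraMap (MvPolynomial (Fin 2) ℂ) QT (MvPolynomial.X 1)

/-- `z_l(q, t) = (∏ i, m_i(l)! i ^ m_i(l)) * ∏ j, (1 - q ^ l_j) / (1 - t ^ l_j)`. -/
def zeta (l : Ptn) : QT :=
  (∏ i ∈ l.toFinset, ((l.count i).factorial : QT) * ((i : ℕ) : QT) ^ l.count i) *
    (l.map fun i : ℕ+ => (1 - q ^ (i : ℕ)) / (1 - t ^ (i : ℕ))).prod

/-- The bilinear form on symmetric functions with `⟨p_l, p_m⟩ = z_l(q, t) δ_{l m}`. -/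
def innerQT : SymFun QT →ₗ[QT] SymFun QT →ₗ[QT] QT :=
  (psumBasis QT).constr QT fun l => zeta l • (psumBasis QT).coord l

theorem innerQT_psumPtn (l m : Ptn) :
    innerQT (psumPtn QT l) (psumPtn QT m) = if l = m then zeta l else 0 := by
  classical
  rw [← psumBasis_apply, ← psumBasis_apply, innerQT, Module.Basis.constr_basis,
    LinearMap.smul_apply, Module.Basis.coord_apply, Module.Basis.repr_self, Finsupp.single_apply]
  by_cases h : l = m
  · simp [h]
  · simp [h, Ne.symm h]

/-- The characterization of the Macdonald symmetric functions `P_l`: `P_l` is `m_l` plus a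
combination of the `m_m` with `m < l` in the dominance order, and different `P_l` are orthogonal.
(A family with the first property is a basis.) -/
structure IsMacdonald (P : Module.Basis Ptn QT (SymFun QT)) : Prop where
  triangular : ∀ l : Ptn, P l - msymm QT l ∈
    Submodule.span QT (msymm QT '' {m | Ptn.DominatedBy m l ∧ m ≠ l})
  orthogonal : ∀ l m : Ptn, l ≠ m → innerQT (P l) (P m) = 0

open Classical in
/-- The Macdonald symmetric functions `P_l`: the family characterized by `IsMacdonald`. There is
exactly one such family (Macdonald), so that the `else` branch, there only to make the definition
total, is not reached. -/
def macP : Module.Basis Ptn QT (SymFun QT) :=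
  if h : ∃ P, IsMacdonald P then h.choose else psumBasis QT

theorem macP_orthogonal {l m : Ptn} (h : l ≠ m) : innerQT (macP l) (macP m) = 0 := by
  rw [macP]
  split_ifs with hP
  · exact hP.choose_spec.orthogonal l m h
  · rw [psumBasis_apply, psumBasis_apply, innerQT_psumPtn, if_neg h]

/-- `Q_l = P_l / ⟨P_l, P_l⟩`. -/
def macQ (l : Ptn) : SymFun QT := (innerQT (macP l) (macP l))⁻¹ • macP l

/-- `F(X)`: the symmetric function `F` in the variables `X 0, X 1, ...`. -/
def evalAt {σ : Type} (F : SymFun QT) (X : ℕ ↪ σ) : MvPowerSeries σ QT := rename X F.1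

/-- `F(X, Y)`: the symmetric function `F` in the union of two sets of variables `X` (left) and
`Y` (right). By symmetry the enumeration of the union is irrelevant. -/
def evalTwo (F : SymFun QT) : MvPowerSeries (ℕ ⊕ ℕ) QT :=
  rename Equiv.natSumNatEquivNat.symm F.1

/-- `F(X, Y) = ∑ m, S_m(X) B_m(Y)`. -/
def IsSkewExpansion (B : Ptn → SymFun QT) (F : SymFun QT) (S : Ptn →₀ SymFun QT) : Prop :=
  evalTwo F = S.sum fun m s =>
    evalAt s Function.Embedding.inl * evalAt (B m) Function.Embedding.inr

open Classical in
/-- The coefficient `S_m` in the expansion `F(X, Y) = ∑ m, S_m(X) B_m(Y)` with respect to a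
basis `B` of the symmetric functions (for a basis it exists and is unique). -/
def skewCoeff (B : Ptn → SymFun QT) (F : SymFun QT) (m : Ptn) : SymFun QT :=
  if h : ∃ S, IsSkewExpansion B F S then h.choose m else 0

/-- `P_{l/m}`, defined by `P_l(X, Y) = ∑ m, P_{l/m}(X) P_m(Y)`. -/
def skewP (l m : Ptn) : SymFun QT := skewCoeff macP (macP l) m

/-- `Q_{l/m}`, defined by `Q_l(X, Y) = ∑ m, Q_{l/m}(X) Q_m(Y)`. -/
def skewQ (l m : Ptn) : SymFun QT := skewCoeff macQ (macQ l) m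

section FormalSums

variable {σ ι A : Type*} [Semiring A]

/-- A family of formal power series is formally summable if each monomial has a nonzero
coefficient in only finitely many members of the family. -/
def FormallySummable (f : ι → MvPowerSeries σ A) : Prop :=
  ∀ e : σ →₀ ℕ, (Function.support fun i => coeff e (f i)).Finite

/-- The sum of a formally summable family, coefficient by coefficient. -/
def formalSum (f : ι → MvPowerSeries σ A) : MvPowerSeries σ A :=
  fun e => ∑ᶠ i, coeff e (f i)

end FormalSums

/-- The Fock space. The induced module is `U(h_-)|0⟩` with `U(h_-)` the polynomial ring in the
commuting generators `a_{-n}`, `n ≥ 1`: the variable `X n` stands for `a_{-n}` and `1` for the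
vacuum `|0⟩`. -/
abbrev Fock : Type := MvPolynomial ℕ+ QT

/-- The dual Fock space `⟨0|U(h_+)`: the variable `X n` stands for `a_n` and `1` for the dual
vacuum `⟨0|`. -/
abbrev DualFock : Type := MvPolynomial ℕ+ QT

/-- The structure constant in `[a_n, a_{-n}] = n (1 - q^n) / (1 - t^n) c`; here `c = 1`. -/
def bracketConst (n : ℕ+) : QT := (n : ℕ) * ((1 - q ^ (n : ℕ)) / (1 - t ^ (n : ℕ)))

/-- The left action of `a_{-n}`, `n ≥ 1`, on the Fock space. -/
def create (n : ℕ+) : Module.End QT Fock := LinearMap.mulLeft QT (MvPolynomial.X n)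

/-- The left action of `a_n`, `n ≥ 1`, on the Fock space. -/
def annihilate (n : ℕ+) : Module.End QT Fock :=
  bracketConst n • (MvPolynomial.pderiv n).toLinearMap

/-- The right action of `a_n`, `n ≥ 1`, on the dual Fock space. -/
def dualCreate (n : ℕ+) : Module.End QT DualFock := LinearMap.mulLeft QT (MvPolynomial.X n)

/-- The right action of `a_{-n}`, `n ≥ 1`, on the dual Fock space. -/
def dualAnnihilate (n : ℕ+) : Module.End QT DualFock :=
  bracketConst n • (MvPolynomial.pderiv n).toLinearMap

theorem create_comm (m n : ℕ+) : create m * create n = create n * create m := by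
  refine LinearMap.ext fun w => ?_
  simp [create, mul_left_comm]

theorem annihilate_comm (m n : ℕ+) :
    annihilate m * annihilate n = annihilate n * annihilate m := by
  have h : ⁅(MvPolynomial.pderiv m : Derivation QT Fock Fock), (MvPolynomial.pderiv n : Derivation QT Fock Fock)⁆ = 0 := by
    refine MvPolynomial.derivation_ext fun i => ?_
    simp [Derivation.commutator_apply, MvPolynomial.pderiv_X, Pi.single_apply, apply_ite]
  refine LinearMap.ext fun w => ?_
  have hw := DFunLike.congr_fun h w
  rw [Derivation.commutator_apply, Derivation.coe_zero, Pi.zero_apply, sub_eq_zero] at hw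
  simp [annihilate, smul_smul, mul_comm, hw]

/-- The Heisenberg relations. -/
theorem annihilate_create (m n : ℕ+) :
    annihilate m * create n - create n * annihilate m =
      if m = n then bracketConst m • (1 : Module.End QT Fock) else 0 := by
  refine LinearMap.ext fun w => ?_
  by_cases h : m = n
  · subst h
    simp [annihilate, create, smul_add]
  · simp [annihilate, create, h, MvPolynomial.pderiv_X_of_ne (Ne.symm h)]

theorem annihilate_vacuum (n : ℕ+) : annihilate n 1 = 0 := by
  simp [annihilate]

/-- The pairing `⟨v|w⟩`. It is the one determined by `⟨0|0⟩ = 1` and the invariance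
`⟨v a_n|w⟩ = ⟨v|a_n w⟩`, as the lemmas `pairing_vacuum`, `pairing_mul_X` and
`pairing_annihilate` below show. -/
def pairing : DualFock →ₗ[QT] Fock →ₗ[QT] QT :=
  (MvPolynomial.basisMonomials ℕ+ QT).constr QT fun s =>
    (s.prod fun i k => (k.factorial : QT) * bracketConst i ^ k) •
      (MvPolynomial.basisMonomials ℕ+ QT).coord s

theorem pairing_monomial (s u : ℕ+ →₀ ℕ) :
    pairing (MvPolynomial.monomial s 1) (MvPolynomial.monomial u 1) =
      if s = u then s.prod (fun i k => (k.factorial : QT) * bracketConst i ^ k) else 0 := by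
  classical
  have h : ∀ v : ℕ+ →₀ ℕ, (MvPolynomial.monomial v 1 : MvPolynomial ℕ+ QT) =
      MvPolynomial.basisMonomials ℕ+ QT v := fun v => by simp
  rw [h, h, pairing, Module.Basis.constr_basis, LinearMap.smul_apply, Module.Basis.coord_apply,
    Module.Basis.repr_self, Finsupp.single_apply]
  by_cases hs : s = u
  · simp [hs]
  · simp [hs, Ne.symm hs]

theorem pairing_vacuum : pairing 1 1 = 1 := by
  have := pairing_monomial 0 0
  simpa using this

theorem weight_add_single (s : ℕ+ →₀ ℕ) (n : ℕ+) :
    (s + Finsupp.single n 1).prod (fun i k => (k.factorial : QT) * bracketConst i ^ k) =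
      ((s n + 1 : ℕ) : QT) * bracketConst n *
        s.prod (fun i k => (k.factorial : QT) * bracketConst i ^ k) := by
  classical
  have h1 := Finsupp.mul_prod_erase' (s + Finsupp.single n 1) n
    (fun i k => (k.factorial : QT) * bracketConst i ^ k) (fun _ => by simp)
  have h2 := Finsupp.mul_prod_erase' s n
    (fun i k => (k.factorial : QT) * bracketConst i ^ k) (fun _ => by simp)
  have h3 : (s + Finsupp.single n 1).erase n = s.erase n := by
    rw [Finsupp.erase_add, Finsupp.erase_single, add_zero]
  rw [← h1, ← h2, h3]
  simp [Nat.factorial_succ, pow_succ]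
  ring

theorem pairing_mul_X (n : ℕ+) (v : DualFock) (w : Fock) :
    pairing (dualCreate n v) w = pairing v (annihilate n w) := by
  have h : pairing ∘ₗ dualCreate n = (pairing.compl₂ (annihilate n)) := by
    refine (MvPolynomial.basisMonomials ℕ+ QT).ext fun s => ?_
    refine (MvPolynomial.basisMonomials ℕ+ QT).ext fun u => ?_
    have hX : (MvPolynomial.X n * MvPolynomial.monomial s 1 : MvPolynomial ℕ+ QT) =
        MvPolynomial.monomial (s + Finsupp.single n 1) 1 := by
      rw [MvPolynomial.X, MvPolynomial.monomial_mul, one_mul, add_comm]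
    have hD : annihilate n (MvPolynomial.monomial u 1) = (bracketConst n * (u n : QT)) •
        MvPolynomial.monomial (u - Finsupp.single n 1) (1 : QT) := by
      simp [annihilate, MvPolynomial.pderiv_monomial, MvPolynomial.smul_monomial]
    simp only [MvPolynomial.coe_basisMonomials, LinearMap.comp_apply, LinearMap.compl₂_apply]
    rw [hD, dualCreate, LinearMap.mulLeft_apply, hX, map_smul, pairing_monomial, pairing_monomial,
      smul_eq_mul]
    by_cases hu : u n = 0
    · have : s + Finsupp.single n 1 ≠ u := fun h => by
        have := DFunLike.congr_fun h n
        simp at this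
        omega
      simp [hu, this]
    · have hiff : s + Finsupp.single n 1 = u ↔ s = u - Finsupp.single n 1 := by
        constructor
        · rintro rfl; simp
        · intro h
          rw [h]
          refine tsub_add_cancel_of_le ?_
          rw [Finsupp.single_le_iff]
          omega
      by_cases hs : s + Finsupp.single n 1 = u
      · rw [if_pos hs, if_pos (hiff.1 hs), weight_add_single]
        have : u n = s n + 1 := by rw [← hs]; simp
        rw [this]
        ring
      · rw [if_neg hs, if_neg (mt hiff.2 hs), mul_zero]
  exact LinearMap.congr_fun (LinearMap.congr_fun h v) w

theorem pairing_symm (v w : MvPolynomial ℕ+ QT) : pairing v w = pairing w v := by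
  have h : pairing = pairing.flip := by
    refine (MvPolynomial.basisMonomials ℕ+ QT).ext fun s => ?_
    refine (MvPolynomial.basisMonomials ℕ+ QT).ext fun u => ?_
    simp only [MvPolynomial.coe_basisMonomials, LinearMap.flip_apply, pairing_monomial]
    by_cases hs : s = u
    · simp [hs]
    · simp [hs, Ne.symm hs]
  exact LinearMap.congr_fun (LinearMap.congr_fun h v) w

theorem pairing_annihilate (n : ℕ+) (v : DualFock) (w : Fock) :
    pairing (dualAnnihilate n v) w = pairing v (create n w) := by
  rw [pairing_symm, pairing_symm v]
  exact (pairing_mul_X n w v).symm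

/-- The basis `|l⟩ = a_{-l_1} a_{-l_2} ... |0⟩`, respectively `⟨l| = ⟨0|a_{l_1} a_{l_2} ...`. -/
def fockBasis : Module.Basis Ptn QT (MvPolynomial ℕ+ QT) :=
  (MvPolynomial.basisMonomials ℕ+ QT).reindex Multiset.toFinsupp.symm.toEquiv

theorem fockBasis_eq_monomial (l : Ptn) :
    fockBasis l = MvPolynomial.monomial (Multiset.toFinsupp l) 1 := by
  simp [fockBasis]

theorem fockBasis_apply (l : Ptn) :
    fockBasis l = (l.map fun n => (MvPolynomial.X n : MvPolynomial ℕ+ QT)).prod := by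
  rw [fockBasis_eq_monomial]
  induction l using Multiset.induction with
  | empty => simp
  | cons n l ih =>
    rw [Multiset.map_cons, Multiset.prod_cons, ← ih, MvPolynomial.X, MvPolynomial.monomial_mul,
      ← Multiset.singleton_add, map_add, Multiset.toFinsupp_singleton, one_mul]

/-- The linear isomorphism that takes the basis `fockBasis` to the power sums. -/
def fockIso : MvPolynomial ℕ+ QT ≃ₗ[QT] SymFun QT :=
  fockBasis.equiv (psumBasis QT) (Equiv.refl _)

/-- The isomorphism `|l⟩ ↦ p_l`. -/
def iota : Fock ≃ₗ[QT] SymFun QT := fockIso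

/-- The isomorphism `⟨l| ↦ p_l`. -/
def iotaDual : DualFock ≃ₗ[QT] SymFun QT := fockIso

theorem fockIso_fockBasis (l : Ptn) : fockIso (fockBasis l) = psumPtn QT l := by
  rw [fockIso, Module.Basis.equiv_apply, psumBasis_apply]; rfl

theorem zeta_eq (l : Ptn) : zeta l =
    (Multiset.toFinsupp l).prod (fun i k => (k.factorial : QT) * bracketConst i ^ k) := by
  rw [zeta, Finset.prod_multiset_map_count, ← Finset.prod_mul_distrib, Finsupp.prod,
    Multiset.toFinsupp_support]
  refine Finset.prod_congr rfl fun i _ => ?_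
  rw [Multiset.toFinsupp_apply, bracketConst, mul_pow]
  ring

theorem pairing_eq_innerQT (v : DualFock) (w : Fock) :
    pairing v w = innerQT (iotaDual v) (iota w) := by
  have h : pairing = innerQT.compl₁₂ (fockIso : _ →ₗ[QT] SymFun QT)
      (fockIso : _ →ₗ[QT] SymFun QT) := by
    refine fockBasis.ext fun l => fockBasis.ext fun m => ?_
    rw [LinearMap.compl₁₂_apply, LinearEquiv.coe_coe, fockIso_fockBasis, fockIso_fockBasis,
      innerQT_psumPtn, fockBasis_eq_monomial, fockBasis_eq_monomial, pairing_monomial, zeta_eq]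
    simp only [EmbeddingLike.apply_eq_iff_eq]
  exact LinearMap.congr_fun (LinearMap.congr_fun h v) w

/-- `|P_l⟩`. -/
def ketP (l : Ptn) : Fock := iota.symm (macP l)

/-- `⟨Q_l|`. -/
def braQ (l : Ptn) : DualFock := iotaDual.symm (macQ l)

theorem braQ_support_finite (w : Fock) :
    {l : Ptn | pairing (braQ l) w ≠ 0}.Finite := by
  refine (macP.repr (iota w)).support.finite_toSet.subset fun l hl => ?_
  have hl' : pairing (braQ l) w ≠ 0 := hl
  rw [pairing_eq_innerQT, braQ, LinearEquiv.apply_symm_apply, macQ] at hl'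
  rw [Finset.mem_coe, Finsupp.mem_support_iff]
  intro h0
  refine hl' ?_
  rw [map_smul, LinearMap.smul_apply]
  have hsum := macP.linearCombination_repr (iota w)
  rw [← hsum, Finsupp.linearCombination_apply, Finsupp.sum, map_sum,
    Finset.sum_eq_zero, smul_zero]
  intro m _
  rw [map_smul]
  by_cases hm : l = m
  · rw [← hm, h0, zero_smul]
  · rw [macP_orthogonal hm, smul_zero]

/-- `O(f) = ∑ l, f(l) |P_l⟩⟨Q_l|`; on every vector the sum has finitely many nonzero terms. -/
def diagOp (f : Ptn → QT) : Module.End QT Fock where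
  toFun w := ∑ᶠ l : Ptn, f l • pairing (braQ l) w • ketP l
  map_add' v w := by
    have hfin : ∀ u : Fock,
        (Function.support fun l : Ptn => f l • pairing (braQ l) u • ketP l).Finite := fun u =>
      (braQ_support_finite u).subset fun l hl h0 => hl (by simp [h0])
    rw [← finsum_add_distrib (hfin v) (hfin w)]
    exact finsum_congr fun l => by rw [map_add, add_smul, smul_add]
  map_smul' c w := by
    have hfin : (Function.support fun l : Ptn => f l • pairing (braQ l) w • ketP l).Finite :=
      (braQ_support_finite w).subset fun l hl h0 => hl (by simp [h0])
    rw [RingHom.id_apply, smul_finsum' c hfin]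
    exact finsum_congr fun l => by
      rw [map_smul, smul_eq_mul, mul_smul, smul_comm (f l) c]

section Vertex

variable {σ : Type}

/-- `(1 - t^n) / (1 - q^n) * (p_n(X) / n) * a n`, as a power series in the variables `X` whose
coefficients are operators on the Fock space. -/
def vertexExponentTerm (X : ℕ ↪ σ) (a : ℕ+ → Module.End QT Fock) (n : ℕ+) :
    MvPowerSeries σ (Module.End QT Fock) :=
  fun e => ((1 - t ^ (n : ℕ)) / (1 - q ^ (n : ℕ)) *
    (coeff e (evalAt (psum QT n) X) / ((n : ℕ) : QT))) • a n

/-- `A ^ k / k!`. -/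
def expTerm (A : MvPowerSeries σ (Module.End QT Fock)) (k : ℕ) :
    MvPowerSeries σ (Module.End QT Fock) :=
  (k.factorial : QT)⁻¹ • A ^ k

/-- `exp A`, for an operator-valued power series `A` without constant term. -/
def formalExp (A : MvPowerSeries σ (Module.End QT Fock)) :
    MvPowerSeries σ (Module.End QT Fock) :=
  formalSum (expTerm A)

theorem degree_of_coeff_evalAt_psum {X : ℕ ↪ σ} {n : ℕ+} {e : σ →₀ ℕ}
    (h : coeff e (evalAt (psum QT n) X) ≠ 0) : e.degree = n := by
  rw [evalAt, coeff_rename] at h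
  obtain ⟨x, hx, hne⟩ := Finset.exists_ne_zero_of_sum_ne_zero h
  have hx' : Finsupp.mapDomain X x = e := by simpa using hx
  have h2 : (if shape x = {n} then (1 : QT) else 0) ≠ 0 := by
    rw [← coeff_psum]; exact hne
  have h3 := (ite_ne_right_iff.1 h2).1
  rw [← hx', Finsupp.degree_mapDomain, ← weight_shape, h3]
  simp [Ptn.weight]

theorem vertexExponentTerm_summable (X : ℕ ↪ σ) (a : ℕ+ → Module.End QT Fock) :
    FormallySummable (vertexExponentTerm X a) := by
  intro e
  refine Set.Subsingleton.finite fun n hn m hm => ?_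
  have h : ∀ n : ℕ+, coeff e (vertexExponentTerm X a n) ≠ 0 → e.degree = n := fun n hn => by
    refine degree_of_coeff_evalAt_psum (X := X) fun h0 => hn ?_
    change ((1 - t ^ (n : ℕ)) / (1 - q ^ (n : ℕ)) *
      (coeff e (evalAt (psum QT n) X) / ((n : ℕ) : QT))) • a n = 0
    rw [h0, zero_div, mul_zero, zero_smul]
  exact PNat.eq ((h n hn).symm.trans (h m hm))

/-- `∑ n ≥ 1, (1 - t^n) / (1 - q^n) * (p_n(X) / n) * a n`. -/
def vertexExponent (X : ℕ ↪ σ) (a : ℕ+ → Module.End QT Fock) :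
    MvPowerSeries σ (Module.End QT Fock) := formalSum (vertexExponentTerm X a)

theorem constantCoeff_vertexExponent (X : ℕ ↪ σ) (a : ℕ+ → Module.End QT Fock) :
    constantCoeff (vertexExponent X a) = 0 := by
  change ∑ᶠ n, coeff 0 (vertexExponentTerm X a n) = 0
  refine finsum_eq_zero_of_forall_eq_zero fun n => ?_
  change ((1 - t ^ (n : ℕ)) / (1 - q ^ (n : ℕ)) *
      (coeff 0 (evalAt (psum QT n) X) / ((n : ℕ) : QT))) • a n = 0
  have : coeff 0 (evalAt (psum QT n) X) = 0 := by
    by_contra h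
    have := degree_of_coeff_evalAt_psum h
    simp at this
    exact n.ne_zero this.symm
  rw [this, zero_div, mul_zero, zero_smul]

theorem expTerm_summable {A : MvPowerSeries σ (Module.End QT Fock)} (hA : constantCoeff A = 0) :
    FormallySummable (expTerm A) := by
  intro e
  refine (Set.finite_Iic e.degree).subset fun k hk => ?_
  by_contra hlt
  refine hk ?_
  have h1 := le_order_pow_of_constantCoeff_eq_zero k hA
  have h2 : coeff e (A ^ k) = 0 := coeff_of_lt_order (lt_of_lt_of_le (by
    rw [Set.mem_Iic, not_le] at hlt
    exact_mod_cast hlt) h1)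
  change coeff e ((k.factorial : QT)⁻¹ • A ^ k) = 0
  change (k.factorial : QT)⁻¹ • coeff e (A ^ k) = 0
  rw [h2, smul_zero]

/-- `Γ(X)_+`, a power series in `X` with coefficients in the endomorphisms of the Fock space. -/
def gammaPlus (X : ℕ ↪ σ) : MvPowerSeries σ (Module.End QT Fock) :=
  formalExp (vertexExponent X annihilate)

/-- `Γ(X)_-`. -/
def gammaMinus (X : ℕ ↪ σ) : MvPowerSeries σ (Module.End QT Fock) :=
  formalExp (vertexExponent X create)

/-- `ψ_f^{X,Y} = Γ(Y)_+ O(f) Γ(X)_-`. -/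
def psi (f : Ptn → QT) (X Y : ℕ ↪ σ) : MvPowerSeries σ (Module.End QT Fock) :=
  gammaPlus Y * C (diagOp f) * gammaMinus X

/-- The vacuum matrix element `⟨0|A|0⟩`, coefficient by coefficient. -/
def vev (A : MvPowerSeries σ (Module.End QT Fock)) : MvPowerSeries σ QT :=
  fun e => pairing 1 (coeff e A 1)

/-- `P_l(X) Q_l(Y)`. -/
def cauchyTerm (X Y : ℕ ↪ σ) (l : Ptn) : MvPowerSeries σ QT :=
  evalAt (macP l) X * evalAt (macQ l) Y

/-- The normalization `Π(X, Y) = ∑ l, P_l(X) Q_l(Y)` of the Macdonald measure. -/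
def cauchyPi (X Y : ℕ ↪ σ) : MvPowerSeries σ QT := formalSum (cauchyTerm X Y)

/-- `Q_{l/v}(Y) P_{m/v}(X)`. -/
def transitionTerm (l m : Ptn) (Y X : ℕ ↪ σ) (v : Ptn) : MvPowerSeries σ QT :=
  evalAt (skewQ l v) Y * evalAt (skewP m v) X

/-- `Ψ_{l,m}(Y, X) = ∑ v, Q_{l/v}(Y) P_{m/v}(X)`. -/
def transition (l m : Ptn) (Y X : ℕ ↪ σ) : MvPowerSeries σ QT :=
  formalSum (transitionTerm l m Y X)

end Vertex

section Steps

/-- The variables of `X^(1), ..., X^(N)` (left) and `Y^(1), ..., Y^(N)` (right), infinitely many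
in each of these `2 N` sets. The steps are numbered from `0`. -/
abbrev Var (N : ℕ) : Type := (Fin N × ℕ) ⊕ (Fin N × ℕ)

/-- The set of variables `X^(i)`. -/
def alphX {N : ℕ} (i : Fin N) : ℕ ↪ Var N :=
  ⟨fun k => Sum.inl (i, k), fun a b h => by simpa using h⟩

/-- The set of variables `Y^(i)`. -/
def alphY {N : ℕ} (i : Fin N) : ℕ ↪ Var N :=
  ⟨fun k => Sum.inr (i, k), fun a b h => by simpa using h⟩

/-- `∏_{i ≤ j} Π(X^(i), Y^(j))`. -/
def normalization (N : ℕ) : MvPowerSeries (Var N) QT :=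
  ∏ i : Fin N, ∏ j ∈ Finset.Ici i, cauchyPi (alphX i) (alphY j)

/-- The numerator of the `N`-step Macdonald process, `N = n + 1`:
`P_{l_1}(X^(1)) Ψ_{l_1,l_2}(Y^(1), X^(2)) ... Ψ_{l_{N-1},l_N}(Y^(N-1), X^(N)) Q_{l_N}(Y^(N))`. -/
def processWeight {n : ℕ} (l : Fin (n + 1) → Ptn) : MvPowerSeries (Var (n + 1)) QT :=
  evalAt (macP (l 0)) (alphX 0) *
    (∏ i : Fin n, transition (l i.castSucc) (l i.succ) (alphY i.castSucc) (alphX i.succ)) *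
    evalAt (macQ (l (Fin.last n))) (alphY (Fin.last n))

/-- The `N`-step Macdonald process, `N = n + 1`, with values in formal power series. -/
def macdonaldProcess {n : ℕ} (l : Fin (n + 1) → Ptn) : MvPowerSeries (Var (n + 1)) QT :=
  processWeight l * (normalization (n + 1))⁻¹

/-- `f_1(l_1) ... f_N(l_N) MP(l_1, ..., l_N)`. -/
def correlationTerm {n : ℕ} (f : Fin (n + 1) → Ptn → QT) (l : Fin (n + 1) → Ptn) :
    MvPowerSeries (Var (n + 1)) QT :=
  (∏ i, f i (l i)) • macdonaldProcess l

/-- The correlation function `E[f_1[1] ... f_N[N]]`. -/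
def correlation {n : ℕ} (f : Fin (n + 1) → Ptn → QT) : MvPowerSeries (Var (n + 1)) QT :=
  formalSum (correlationTerm f)

/-- `ψ_{f_N} ... ψ_{f_1}`, with the operator of the first step on the right. -/
def psiProduct {N : ℕ} (f : Fin N → Ptn → QT) :
    MvPowerSeries (Var N) (Module.End QT Fock) :=
  (List.ofFn fun i => psi (f i) (alphX i) (alphY i)).reverse.prod

end Steps

end
end MacFock

/-!
The proof evaluates both sides through matrix elements `⟨φ|A|w⟩` of operator-valued power series.

The left side. `Γ(X)_+` commutes with the creation operators up to the shift
`a_{-n} ↦ a_{-n} + p_n(X)` and fixes the vacuum, so on the Fock space, identified with the symmetric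
functions, it is the substitution `F ↦ F(X, ·)`. Hence its matrix elements between `⟨P_v|` and
`|Q_l⟩` are the skew functions `Q_{l/v}(X)`, and those between `⟨0|` and `|F⟩` are `F(X)`. The
operator `Γ(X)_-` is adjoint to `Γ(X)_+`. Consequently
`⟨P_m|Γ(X)_- Γ(Y)_+|Q_l⟩ = Ψ_{l,m}(Y, X)` (`transition_eq_matrixElement`), and inserting
`O(f) = ∑ l, f(l) |Q_l⟩⟨P_l|` at every step turns `⟨0|ψ_{f_N} ... ψ_{f_1}|0⟩` into the sum of the
numerators of the process (`matrixElement_psiSeq_mul`). The form `|Q_l⟩⟨P_l| = |P_l⟩⟨Q_l|` is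
legitimate because `Q_l` is a multiple of `P_l`.

The denominator. For `f = 1` orthogonality gives `O(1) = 1` (`diagOp_one`), so that
`Π(X, Y) = ⟨0|Γ(Y)_+ Γ(X)_-|0⟩` and `Γ(Y)_+ Γ(X)_- = Π(X, Y) Γ(X)_- Γ(Y)_+`
(`gammaPlus_mul_gammaMinus`). Moving all `Γ_+` to the right produces one factor `Π(X^(i), Y^(j))`
for each `i ≤ j` (`vev_psiSeq_one`).

Identities between operators are deduced from a uniqueness principle (`ShiftsBy.ext`): an operator
series that shifts every `a_{-n}` by a given scalar series is determined by its value on the vacuum.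

Formal convergence comes from `ketP_support_finite`: a vector has only finitely many nonzero
coefficients `⟨P_l|w⟩`. Of the Macdonald functions the argument uses only that they form an
orthogonal basis.
-/

namespace MacFock

noncomputable section

open MvPowerSeries TensorProduct

/-! ### The parameters and scalar series -/

theorem one_sub_algebraMap_X_pow_ne_zero (i : Fin 2) (n : ℕ+) :
    (1 : QT) - algebraMap (MvPolynomial (Fin 2) ℂ) QT (MvPolynomial.X i) ^ (n : ℕ) ≠ 0 := by
  intro h
  rw [← map_one (algebraMap (MvPolynomial (Fin 2) ℂ) QT), ← map_pow, ← map_sub] at h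
  have h1 := congrArg (MvPolynomial.eval 0)
    ((FaithfulSMul.algebraMap_injective (MvPolynomial (Fin 2) ℂ) QT) (h.trans (map_zero _).symm))
  simp at h1

theorem one_sub_q_pow_ne_zero (n : ℕ+) : (1 : QT) - q ^ (n : ℕ) ≠ 0 :=
  one_sub_algebraMap_X_pow_ne_zero 0 n

theorem one_sub_t_pow_ne_zero (n : ℕ+) : (1 : QT) - t ^ (n : ℕ) ≠ 0 :=
  one_sub_algebraMap_X_pow_ne_zero 1 n

variable {σ : Type}

/-- Formal power series whose coefficients are operators on the Fock space. -/
abbrev OpSeries (σ : Type) : Type := MvPowerSeries σ (Module.End QT Fock)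

/-- A scalar power series as a power series of multiples of the identity operator. -/
def scalarSeries : MvPowerSeries σ QT →+* OpSeries σ :=
  MvPowerSeries.map (algebraMap QT (Module.End QT Fock))

theorem scalarSeries_commute (s : MvPowerSeries σ QT) (T : OpSeries σ) :
    Commute (scalarSeries s) T := by
  classical
  ext1 e
  rw [coeff_mul, coeff_mul, ← Finset.sum_equiv (Equiv.prodComm _ _) (s := Finset.HasAntidiagonal.antidiagonal e)
    (t := Finset.HasAntidiagonal.antidiagonal e)]
  · intro x; simp [add_comm]
  · intro x _
    simp only [scalarSeries, coeff_map, Equiv.prodComm_apply, Prod.fst_swap, Prod.snd_swap]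
    exact (Algebra.commutes (A := Module.End QT Fock) (coeff x.2 s) (coeff x.1 T)).symm

/-! ### Matrix elements -/

/-- The matrix element `⟨φ|A|w⟩` of an operator-valued power series, coefficient by coefficient. The
bra is an arbitrary linear functional, so that operators standing on the left of `A` can be absorbed
into it. -/
def matrixElement (φ : Fock →ₗ[QT] QT) (w : Fock) : OpSeries σ →ₗ[QT] MvPowerSeries σ QT where
  toFun T := fun e => φ (coeff e T w)
  map_add' S T := by ext1 e; change φ (coeff e (S + T) w) = φ (coeff e S w) + φ (coeff e T w); simp
  map_smul' c T := by
    ext1 e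
    change φ (c • coeff e T w) = c * φ (coeff e T w)
    simp

theorem coeff_matrixElement (φ : Fock →ₗ[QT] QT) (w : Fock) (T : OpSeries σ) (e : σ →₀ ℕ) :
    coeff e (matrixElement φ w T) = φ (coeff e T w) := rfl

theorem matrixElement_C_mul (φ : Fock →ₗ[QT] QT) (w : Fock) (c : Module.End QT Fock)
    (T : OpSeries σ) : matrixElement φ w (C c * T) = matrixElement (φ ∘ₗ c) w T := by
  ext1 e
  simp [coeff_matrixElement, coeff_C_mul]

theorem matrixElement_mul_C (φ : Fock →ₗ[QT] QT) (w : Fock) (c : Module.End QT Fock)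
    (T : OpSeries σ) : matrixElement φ w (T * C c) = matrixElement φ (c w) T := by
  ext1 e
  simp [coeff_matrixElement, coeff_mul_C]

theorem matrixElement_scalarSeries_mul (φ : Fock →ₗ[QT] QT) (w : Fock) (s : MvPowerSeries σ QT)
    (T : OpSeries σ) : matrixElement φ w (scalarSeries s * T) = s * matrixElement φ w T := by
  classical
  ext1 e
  simp [coeff_matrixElement, coeff_mul, scalarSeries, LinearMap.sum_apply]

theorem matrixElement_one (φ : Fock →ₗ[QT] QT) (w : Fock) :
    matrixElement φ w (1 : OpSeries σ) = C (φ w) := by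
  classical
  ext1 e
  rw [coeff_matrixElement, coeff_one, coeff_C]
  split_ifs <;> simp

theorem matrixElement_add_vector (φ : Fock →ₗ[QT] QT) (v w : Fock) (T : OpSeries σ) :
    matrixElement φ (v + w) T = matrixElement φ v T + matrixElement φ w T := by
  ext1 e; simp [coeff_matrixElement]

theorem matrixElement_smul_vector (φ : Fock →ₗ[QT] QT) (c : QT) (w : Fock) (T : OpSeries σ) :
    matrixElement φ (c • w) T = c • matrixElement φ w T := by
  ext1 e; simp [coeff_matrixElement]

/-! ### Formal exponentials -/

/-- `∑ k < M, A ^ k / k!`, which agrees with `exp A` in degrees less than `M`. -/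
def expTrunc (A : OpSeries σ) (M : ℕ) : OpSeries σ := ∑ k ∈ Finset.range M, expTerm A k

theorem coeff_expTerm_eq_zero {A : OpSeries σ} (hA : constantCoeff A = 0) {k : ℕ} {e : σ →₀ ℕ}
    (h : e.degree < k) : coeff e (expTerm A k) = 0 := by
  have h2 : coeff e (A ^ k) = 0 := coeff_of_lt_order (lt_of_lt_of_le
    (by exact_mod_cast h) (le_order_pow_of_constantCoeff_eq_zero k hA))
  change (k.factorial : QT)⁻¹ • coeff e (A ^ k) = 0
  rw [h2, smul_zero]

theorem coeff_formalExp {A : OpSeries σ} (hA : constantCoeff A = 0) {M : ℕ} {e : σ →₀ ℕ}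
    (h : e.degree < M) : coeff e (formalExp A) = coeff e (expTrunc A M) := by
  rw [expTrunc, map_sum]
  refine finsum_eq_sum_of_support_subset _ fun k hk => ?_
  rw [Finset.coe_range, Set.mem_Iio]
  by_contra hle
  exact hk (coeff_expTerm_eq_zero hA (by omega))

theorem degree_le_of_mem_antidiagonal [DecidableEq σ] {e : σ →₀ ℕ} {x : (σ →₀ ℕ) × (σ →₀ ℕ)}
    (hx : x ∈ Finset.HasAntidiagonal.antidiagonal e) : x.1.degree ≤ e.degree ∧ x.2.degree ≤ e.degree := by
  rw [← Finset.HasAntidiagonal.mem_antidiagonal.1 hx, map_add]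
  omega

theorem coeff_formalExp_mul {A : OpSeries σ} (hA : constantCoeff A = 0) (B : OpSeries σ)
    {M : ℕ} {e : σ →₀ ℕ} (h : e.degree < M) :
    coeff e (formalExp A * B) = coeff e (expTrunc A M * B) := by
  classical
  rw [coeff_mul, coeff_mul]
  exact Finset.sum_congr rfl fun x hx => by
    rw [coeff_formalExp hA ((degree_le_of_mem_antidiagonal hx).1.trans_lt h)]

theorem coeff_mul_formalExp {A : OpSeries σ} (hA : constantCoeff A = 0) (B : OpSeries σ)
    {M : ℕ} {e : σ →₀ ℕ} (h : e.degree < M) :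
    coeff e (B * formalExp A) = coeff e (B * expTrunc A M) := by
  classical
  rw [coeff_mul, coeff_mul]
  exact Finset.sum_congr rfl fun x hx => by
    rw [coeff_formalExp hA ((degree_le_of_mem_antidiagonal hx).2.trans_lt h)]

theorem pow_mul_of_commutator {R : Type*} [Ring R] {A c p : R} (h : A * c = c * A + p)
    (hp : Commute A p) (k : ℕ) :
    A ^ k * c = c * A ^ k + k • (p * A ^ (k - 1)) := by
  induction k with
  | zero => simp
  | succ k ih =>
    rw [pow_succ', mul_assoc, ih, mul_add, ← mul_assoc, h, mul_smul_comm, ← mul_assoc A p, hp.eq,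
      mul_assoc p, Nat.add_sub_cancel, succ_nsmul, add_mul, mul_assoc c]
    rcases k with _ | k
    · simp
    · rw [Nat.add_sub_cancel, ← pow_succ' A k, ← pow_succ' A (k + 1)]
      simp only [succ_nsmul, add_assoc, add_comm, add_left_comm]

theorem expTrunc_mul {A c p : OpSeries σ} (h : A * c = c * A + p) (hp : Commute A p) (M : ℕ) :
    expTrunc A (M + 1) * c = c * expTrunc A (M + 1) + p * expTrunc A M := by
  have key : ∀ k, expTerm A (k + 1) * c = c * expTerm A (k + 1) + p * expTerm A k := fun k => by
    have h1 := pow_mul_of_commutator (R := OpSeries σ) (A := A) (c := c) (p := p) h hp (k + 1)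
    have hk : ((k + 1 : ℕ) : QT) ≠ 0 := by exact_mod_cast k.succ_ne_zero
    rw [expTerm, expTerm, smul_mul_assoc, h1, mul_smul_comm, mul_smul_comm, smul_add,
      Nat.add_sub_cancel, ← Nat.cast_smul_eq_nsmul QT, smul_smul]
    congr 2
    rw [Nat.factorial_succ, Nat.cast_mul, mul_inv, mul_right_comm, inv_mul_cancel₀ hk, one_mul]
  have h0 : expTerm A 0 * c = c * expTerm A 0 := by simp [expTerm]
  rw [expTrunc, Finset.sum_range_succ', add_mul, Finset.sum_mul, Finset.sum_congr rfl
    (fun k _ => key k), Finset.sum_add_distrib, ← Finset.mul_sum, ← Finset.mul_sum, h0, mul_add,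
    expTrunc]
  abel

/-- If `[A, c] = p` commutes with `A`, then `exp A * c = (c + p) * exp A`. -/
theorem formalExp_mul {A c p : OpSeries σ} (hA : constantCoeff A = 0) (h : A * c = c * A + p)
    (hp : Commute A p) : formalExp A * c = (c + p) * formalExp A := by
  ext1 e
  have hM : e.degree < e.degree + 1 := Nat.lt_succ_self _
  have hM' : e.degree < e.degree + 1 + 1 := by omega
  rw [add_mul, map_add, coeff_formalExp_mul hA c hM', coeff_mul_formalExp hA c hM',
    coeff_mul_formalExp hA p hM, expTrunc_mul h hp, map_add]

theorem coeff_zero_formalExp {A : OpSeries σ} (hA : constantCoeff A = 0) :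
    coeff 0 (formalExp A) = 1 := by
  rw [coeff_formalExp hA (M := 1) (by simp)]
  simp [expTrunc, expTerm]

/-! ### Adjoint operators -/

/-- `S` is the adjoint of `T` for the pairing, coefficient by coefficient; as the Fock space and its
dual are both the polynomial ring, `S` can be an operator on the Fock space again. -/
def IsAdjoint (S T : OpSeries σ) : Prop :=
  ∀ (e : σ →₀ ℕ) (v w : Fock), pairing v (coeff e T w) = pairing (coeff e S v) w

theorem IsAdjoint.symm {S T : OpSeries σ} (h : IsAdjoint S T) : IsAdjoint T S := fun e v w => by
  rw [pairing_symm v, pairing_symm _ w, h e w v]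

theorem IsAdjoint.mul {S T S' T' : OpSeries σ} (h : IsAdjoint S T) (h' : IsAdjoint S' T') :
    IsAdjoint (S' * S) (T * T') := fun e v w => by
  classical
  rw [coeff_mul, coeff_mul, LinearMap.sum_apply, LinearMap.sum_apply, map_sum, map_sum,
    LinearMap.sum_apply, ← Finset.sum_equiv (Equiv.prodComm _ _)
      (s := Finset.HasAntidiagonal.antidiagonal e) (t := Finset.HasAntidiagonal.antidiagonal e)]
  · intro x; simp [add_comm]
  · intro x _
    simp only [Equiv.prodComm_apply, Prod.fst_swap, Prod.snd_swap, Module.End.mul_apply]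
    rw [h, h']

theorem IsAdjoint.one : IsAdjoint (1 : OpSeries σ) 1 := fun e v w => by
  classical
  rw [coeff_one]
  split_ifs <;> simp

theorem IsAdjoint.pow {S T : OpSeries σ} (h : IsAdjoint S T) (k : ℕ) :
    IsAdjoint (S ^ k) (T ^ k) := by
  induction k with
  | zero => simpa using IsAdjoint.one
  | succ k ih => rw [pow_succ, pow_succ']; exact h.mul ih

theorem IsAdjoint.formalExp {S T : OpSeries σ} (h : IsAdjoint S T) (hS : constantCoeff S = 0)
    (hT : constantCoeff T = 0) : IsAdjoint (formalExp S) (formalExp T) := fun e v w => by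
  rw [coeff_formalExp hS (Nat.lt_succ_self _), coeff_formalExp hT (Nat.lt_succ_self _),
    expTrunc, expTrunc, map_sum, map_sum, LinearMap.sum_apply, LinearMap.sum_apply, map_sum,
    map_sum, LinearMap.sum_apply]
  refine Finset.sum_congr rfl fun k _ => ?_
  change pairing v ((k.factorial : QT)⁻¹ • coeff e (T ^ k) w) =
    pairing ((k.factorial : QT)⁻¹ • coeff e (S ^ k) v) w
  rw [map_smul, map_smul, LinearMap.smul_apply, h.pow k]

theorem IsAdjoint.matrixElement {S T : OpSeries σ} (h : IsAdjoint S T) (v w : Fock) :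
    matrixElement (pairing v) w T = matrixElement (pairing w) v S := by
  ext1 e
  rw [coeff_matrixElement, coeff_matrixElement, h, pairing_symm]

/-! ### Commutation relations of the vertex operators -/

/-- The finite range of summation does not depend on the operators `a n`. -/
theorem exists_coeff_vertexExponent (X : ℕ ↪ σ) (e : σ →₀ ℕ) : ∃ s : Finset ℕ+,
    (∀ n ∉ s, coeff e (evalAt (psum QT n) X) = 0) ∧ ∀ a : ℕ+ → Module.End QT Fock,
    coeff e (vertexExponent X a) = ∑ n ∈ s, ((1 - t ^ (n : ℕ)) / (1 - q ^ (n : ℕ)) *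
    (coeff e (evalAt (psum QT n) X) / ((n : ℕ) : QT))) • a n := by
  have hfin : {n : ℕ+ | coeff e (evalAt (psum QT n) X) ≠ 0}.Finite :=
    Set.Subsingleton.finite fun n hn m hm =>
      PNat.eq ((degree_of_coeff_evalAt_psum hn).symm.trans (degree_of_coeff_evalAt_psum hm))
  refine ⟨hfin.toFinset, fun n hn => by simpa using hn, fun a => ?_⟩
  refine finsum_eq_sum_of_support_subset _ fun n hn => ?_
  rw [Set.Finite.coe_toFinset]
  intro h0
  refine hn ?_
  change ((1 - t ^ (n : ℕ)) / (1 - q ^ (n : ℕ)) *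
    (coeff e (evalAt (psum QT n) X) / ((n : ℕ) : QT))) • a n = 0
  rw [h0, zero_div, mul_zero, zero_smul]

theorem vertexExponent_create_mul_C_create (X : ℕ ↪ σ) (m : ℕ+) :
    vertexExponent X create * C (create m) = C (create m) * vertexExponent X create + 0 := by
  ext1 e
  obtain ⟨s, -, hs⟩ := exists_coeff_vertexExponent X e
  rw [add_zero, coeff_mul_C, coeff_C_mul, hs, Finset.sum_mul, Finset.mul_sum]
  exact Finset.sum_congr rfl fun n _ => by rw [smul_mul_assoc, mul_smul_comm, create_comm]

theorem vertexExponent_annihilate_mul_C_create (X : ℕ ↪ σ) (m : ℕ+) :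
    vertexExponent X annihilate * C (create m) = C (create m) * vertexExponent X annihilate +
      scalarSeries (evalAt (psum QT m) X) := by
  ext1 e
  obtain ⟨s, hs0, hs⟩ := exists_coeff_vertexExponent X e
  have hac : ∀ n, annihilate n * create m = create m * annihilate n +
      if n = m then bracketConst n • (1 : Module.End QT Fock) else 0 := fun n => by
    rw [← annihilate_create]; abel
  rw [map_add, coeff_mul_C, coeff_C_mul, hs, Finset.sum_mul, Finset.mul_sum]
  simp_rw [smul_mul_assoc, mul_smul_comm, hac, smul_add, Finset.sum_add_distrib, smul_ite,
    smul_zero, Finset.sum_ite_eq', scalarSeries, coeff_map]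
  congr 1
  split_ifs with hm
  · have h1 := one_sub_q_pow_ne_zero m
    have h2 := one_sub_t_pow_ne_zero m
    have h3 : ((m : ℕ) : QT) ≠ 0 := by exact_mod_cast m.ne_zero
    rw [Algebra.algebraMap_eq_smul_one, smul_smul, bracketConst]
    -- The coefficients in the exponent are chosen to cancel the Heisenberg bracket.
    congr 1
    field_simp
  · rw [hs0 m hm, map_zero]

theorem isAdjoint_vertexExponent (X : ℕ ↪ σ) :
    IsAdjoint (vertexExponent X annihilate) (vertexExponent X create) := fun e v w => by
  obtain ⟨s, -, hs⟩ := exists_coeff_vertexExponent X e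
  rw [hs, hs, LinearMap.sum_apply, LinearMap.sum_apply, map_sum, map_sum, LinearMap.sum_apply]
  refine Finset.sum_congr rfl fun n _ => ?_
  rw [LinearMap.smul_apply, LinearMap.smul_apply, map_smul, map_smul, LinearMap.smul_apply,
    ← pairing_annihilate]
  rfl

theorem isAdjoint_gamma (X : ℕ ↪ σ) : IsAdjoint (gammaPlus X) (gammaMinus X) :=
  (isAdjoint_vertexExponent X).formalExp (constantCoeff_vertexExponent X _)
    (constantCoeff_vertexExponent X _)

/-- `T a_{-n} = (a_{-n} + s_n) T` for all `n`, with scalar series `s_n`. -/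
def ShiftsBy (T : OpSeries σ) (s : ℕ+ → MvPowerSeries σ QT) : Prop :=
  ∀ n, T * C (create n) = (C (create n) + scalarSeries (s n)) * T

theorem shiftsBy_gammaPlus (X : ℕ ↪ σ) :
    ShiftsBy (gammaPlus X) fun n => evalAt (psum QT n) X := fun n =>
  formalExp_mul (constantCoeff_vertexExponent X _) (vertexExponent_annihilate_mul_C_create X n)
    (scalarSeries_commute _ _).symm

theorem shiftsBy_gammaMinus (X : ℕ ↪ σ) : ShiftsBy (gammaMinus X) 0 := fun n => by
  rw [Pi.zero_apply, map_zero]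
  exact formalExp_mul (constantCoeff_vertexExponent X _) (vertexExponent_create_mul_C_create X n)
    (Commute.zero_right _)

theorem ShiftsBy.mul {S T : OpSeries σ} {s u : ℕ+ → MvPowerSeries σ QT} (hS : ShiftsBy S s)
    (hT : ShiftsBy T u) : ShiftsBy (S * T) (s + u) := fun n => by
  rw [mul_assoc, hT n, ← mul_assoc, mul_add, hS n, ← (scalarSeries_commute (u n) S).eq, ← add_mul,
    mul_assoc, Pi.add_apply, map_add, add_assoc]

theorem ShiftsBy.scalarSeries_mul {T : OpSeries σ} {s : ℕ+ → MvPowerSeries σ QT}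
    (hT : ShiftsBy T s) (r : MvPowerSeries σ QT) : ShiftsBy (scalarSeries r * T) s := fun n => by
  rw [mul_assoc, hT n, ← mul_assoc, ← mul_assoc, (scalarSeries_commute r _).eq]

theorem ShiftsBy.matrixElement_mul_X {T : OpSeries σ} {s : ℕ+ → MvPowerSeries σ QT}
    (hT : ShiftsBy T s) (φ : Fock →ₗ[QT] QT) (w : Fock) (n : ℕ+) :
    matrixElement φ (w * MvPolynomial.X n) T =
      matrixElement (φ ∘ₗ create n) w T + s n * matrixElement φ w T := by
  have : w * MvPolynomial.X n = create n w := by simp [create, mul_comm]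
  rw [this, ← matrixElement_mul_C, hT n, add_mul, map_add, matrixElement_C_mul,
    matrixElement_scalarSeries_mul]

theorem matrixElement_C_vector (φ : Fock →ₗ[QT] QT) (c : QT) (T : OpSeries σ) :
    matrixElement φ (MvPolynomial.C c) T = c • matrixElement φ 1 T := by
  rw [← matrixElement_smul_vector, MvPolynomial.smul_eq_C_mul, mul_one]

/-- An operator series with a given shift is determined by its value on the vacuum, because the
creation operators generate the Fock space. -/
theorem ShiftsBy.ext {S T : OpSeries σ} {s : ℕ+ → MvPowerSeries σ QT} (hS : ShiftsBy S s)
    (hT : ShiftsBy T s) (h : ∀ φ, matrixElement φ 1 S = matrixElement φ 1 T) : S = T := by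
  have key : ∀ (w : Fock) (φ : Fock →ₗ[QT] QT), matrixElement φ w S = matrixElement φ w T := by
    intro w
    induction w using MvPolynomial.induction_on with
    | C c => intro φ; rw [matrixElement_C_vector, matrixElement_C_vector, h]
    | add v w hv hw =>
      intro φ; rw [matrixElement_add_vector, matrixElement_add_vector, hv, hw]
    | mul_X w n hw => intro φ; rw [hS.matrixElement_mul_X, hT.matrixElement_mul_X, hw, hw]
  ext1 e
  refine LinearMap.ext fun w => MvPolynomial.ext _ _ fun m => ?_
  exact congrArg (coeff e) (key w (MvPolynomial.lcoeff QT m))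

theorem pairing_one_comp_create (n : ℕ+) : pairing 1 ∘ₗ create n = 0 := by
  refine LinearMap.ext fun w => ?_
  rw [LinearMap.comp_apply, ← pairing_annihilate]
  change pairing (annihilate n 1) w = 0
  rw [annihilate_vacuum, map_zero, LinearMap.zero_apply]

/-- Since `⟨0|a_{-n} = 0`, each creation operator in `w` is replaced by its shift. -/
theorem ShiftsBy.matrixElement_pairing_one {T : OpSeries σ} {s : ℕ+ → MvPowerSeries σ QT}
    (hT : ShiftsBy T s) (w : Fock) :
    matrixElement (pairing 1) w T = MvPolynomial.aeval s w * matrixElement (pairing 1) 1 T := by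
  induction w using MvPolynomial.induction_on with
  | C c => rw [matrixElement_C_vector, MvPolynomial.aeval_C, Algebra.smul_def]
  | add v w hv hw => rw [matrixElement_add_vector, hv, hw, map_add, add_mul]
  | mul_X w n hw =>
    have h0 : matrixElement (0 : Fock →ₗ[QT] QT) w T = 0 := rfl
    rw [hT.matrixElement_mul_X, hw, map_mul, MvPolynomial.aeval_X, pairing_one_comp_create, h0]
    ring

/-- `Γ(X)_+|0⟩ = |0⟩`. -/
theorem matrixElement_mul_gammaPlus_one (φ : Fock →ₗ[QT] QT) (T : OpSeries σ) (X : ℕ ↪ σ) :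
    matrixElement φ 1 (T * gammaPlus X) = matrixElement φ 1 T := by
  classical
  have h1 : ∀ e, coeff e (vertexExponent X annihilate) 1 = 0 := fun e => by
    obtain ⟨s, -, hs⟩ := exists_coeff_vertexExponent X e
    rw [hs, LinearMap.sum_apply]
    exact Finset.sum_eq_zero fun n _ => by
      rw [LinearMap.smul_apply, annihilate_vacuum, smul_zero]
  have h2 : ∀ e (k : ℕ),
      (coeff e (vertexExponent X annihilate ^ (k + 1)) : Module.End QT Fock) 1 = 0 := fun e k => by
    rw [pow_succ, coeff_mul, LinearMap.sum_apply]
    exact Finset.sum_eq_zero fun x _ => by rw [Module.End.mul_apply, h1, map_zero]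
  have h3 : ∀ e, coeff e (gammaPlus X) 1 = coeff e (1 : OpSeries σ) 1 := fun e => by
    rw [gammaPlus, coeff_formalExp (constantCoeff_vertexExponent X _) (Nat.lt_succ_self _),
      expTrunc, map_sum, LinearMap.sum_apply, Finset.sum_range_succ', Finset.sum_eq_zero, zero_add]
    · simp [expTerm]
    · intro k _
      have h4 : coeff e (expTerm (vertexExponent X annihilate) (k + 1)) =
        ((k + 1).factorial : QT)⁻¹ • coeff e (vertexExponent X annihilate ^ (k + 1)) := rfl
      rw [h4, LinearMap.smul_apply, h2, smul_zero]
  conv_rhs => rw [← mul_one T]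
  ext1 e
  rw [coeff_matrixElement, coeff_matrixElement, coeff_mul, coeff_mul, LinearMap.sum_apply,
    LinearMap.sum_apply]
  congr 1
  exact Finset.sum_congr rfl fun x _ => by rw [Module.End.mul_apply, Module.End.mul_apply, h3]

/-- `⟨0|Γ(X)_- = ⟨0|`. -/
theorem matrixElement_gammaMinus_mul (w : Fock) (T : OpSeries σ) (X : ℕ ↪ σ) :
    matrixElement (pairing 1) w (gammaMinus X * T) = matrixElement (pairing 1) w T := by
  classical
  have h : ∀ e v, pairing 1 (coeff e (gammaMinus X) v) = pairing 1 (coeff e (1 : OpSeries σ) v) := by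
    intro e v
    have h1 := congrArg (coeff e) (matrixElement_mul_gammaPlus_one (pairing v) 1 X)
    rw [one_mul, ← (isAdjoint_gamma X).matrixElement, ← IsAdjoint.one.matrixElement] at h1
    exact h1
  conv_rhs => rw [← one_mul T]
  ext1 e
  rw [coeff_matrixElement, coeff_matrixElement, coeff_mul, coeff_mul, LinearMap.sum_apply,
    LinearMap.sum_apply, map_sum, map_sum]
  exact Finset.sum_congr rfl fun x _ => by rw [Module.End.mul_apply, Module.End.mul_apply, h]


/-! ### Symmetric functions as matrix elements -/

theorem fockIso_eq_aeval (w : Fock) : fockIso w = MvPolynomial.aeval (psum QT) w := by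
  have h : (fockIso : Fock →ₗ[QT] SymFun QT) = (MvPolynomial.aeval (psum QT)).toLinearMap := by
    refine fockBasis.ext fun l => ?_
    rw [LinearEquiv.coe_coe, fockIso_fockBasis, AlgHom.toLinearMap_apply, fockBasis_apply,
      map_multiset_prod, Multiset.map_map, psumPtn]
    simp
  exact LinearMap.congr_fun h w

/-- `F ↦ F(X)` as an algebra homomorphism. -/
def evalAtHom (X : ℕ ↪ σ) : SymFun QT →ₐ[QT] MvPowerSeries σ QT :=
  (rename X).comp (SymFun QT).val

theorem evalAtHom_apply (X : ℕ ↪ σ) (F : SymFun QT) : evalAtHom X F = evalAt F X := rfl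

theorem matrixElement_pairing_one_gammaPlus (v : Fock) (X : ℕ ↪ σ) :
    matrixElement (pairing 1) v (gammaPlus X) = evalAt (iota v) X := by
  have h1 := matrixElement_mul_gammaPlus_one (pairing 1) 1 X
  rw [one_mul, matrixElement_one, pairing_vacuum, map_one (C (σ := σ) (R := QT))] at h1
  rw [(shiftsBy_gammaPlus X).matrixElement_pairing_one, h1, mul_one, iota, fockIso_eq_aeval,
    ← evalAtHom_apply]
  exact (DFunLike.congr_fun (MvPolynomial.comp_aeval (psum QT) (evalAtHom X)) v).symm

theorem matrixElement_one_gammaMinus (v : Fock) (X : ℕ ↪ σ) :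
    matrixElement (pairing v) 1 (gammaMinus X) = evalAt (iota v) X := by
  rw [(isAdjoint_gamma X).matrixElement, matrixElement_pairing_one_gammaPlus]

/-! ### The coproduct and skew functions -/

/-- The coproduct `F ↦ F(X, Y)` with values in the tensor square of the symmetric functions, which
stands for the functions that are symmetric in `X` and in `Y` separately. -/
def coproduct : Fock →ₐ[QT] SymFun QT ⊗[QT] SymFun QT :=
  MvPolynomial.aeval fun n => psum QT n ⊗ₜ 1 + 1 ⊗ₜ psum QT n

/-- `F ⊗ G ↦ φ(G) F(X)`. -/
def contract (X : ℕ ↪ σ) (φ : SymFun QT →ₗ[QT] QT) :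
    SymFun QT ⊗[QT] SymFun QT →ₗ[QT] MvPowerSeries σ QT :=
  TensorProduct.lift
    ((LinearMap.lsmul QT (MvPowerSeries σ QT)).flip.compl₁₂ (evalAtHom X).toLinearMap φ)

theorem contract_tmul (X : ℕ ↪ σ) (φ : SymFun QT →ₗ[QT] QT) (F G : SymFun QT) :
    contract X φ (F ⊗ₜ G) = φ G • evalAt F X := rfl

theorem contract_mul_coproduct_X (X : ℕ ↪ σ) (φ : SymFun QT →ₗ[QT] QT) (n : ℕ+)
    (z : SymFun QT ⊗[QT] SymFun QT) :
    contract X φ (z * (psum QT n ⊗ₜ 1 + 1 ⊗ₜ psum QT n)) =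
      contract X (φ ∘ₗ LinearMap.mulLeft QT (psum QT n)) z +
        evalAt (psum QT n) X * contract X φ z := by
  induction z using TensorProduct.induction_on with
  | zero => simp
  | add y z hy hz => rw [add_mul, map_add, map_add, map_add, hy, hz]; ring
  | tmul F G =>
    rw [mul_add, Algebra.TensorProduct.tmul_mul_tmul, Algebra.TensorProduct.tmul_mul_tmul, map_add,
      contract_tmul, contract_tmul, contract_tmul, contract_tmul, mul_one, mul_one, add_comm,
      ← evalAtHom_apply X (F * _), map_mul (evalAtHom X), LinearMap.comp_apply,
      LinearMap.mulLeft_apply, mul_comm G, mul_smul_comm, mul_comm (evalAtHom X F)]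
    rfl

/-- `Γ(X)_+` acts on the symmetric functions as `F ↦ F(X, ·)`. -/
theorem matrixElement_gammaPlus_eq_contract (X : ℕ ↪ σ) (w : Fock) (φ : SymFun QT →ₗ[QT] QT) :
    matrixElement (φ ∘ₗ iota.toLinearMap) w (gammaPlus X) = contract X φ (coproduct w) := by
  induction w using MvPolynomial.induction_on generalizing φ with
  | C c =>
    have h1 := matrixElement_mul_gammaPlus_one (φ ∘ₗ iota.toLinearMap) 1 X
    have h2 : iota 1 = 1 := by rw [iota, fockIso_eq_aeval, map_one]
    rw [one_mul, matrixElement_one] at h1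
    rw [matrixElement_C_vector, h1, ← MvPolynomial.algebraMap_eq, AlgHom.commutes,
      Algebra.algebraMap_eq_smul_one, map_smul, Algebra.TensorProduct.one_def, contract_tmul,
      ← evalAtHom_apply, map_one (evalAtHom X), LinearMap.comp_apply, LinearEquiv.coe_coe, h2,
      ← Algebra.algebraMap_eq_smul_one (φ 1)]
    rfl
  | add v w hv hw => rw [matrixElement_add_vector, hv, hw, map_add, map_add]
  | mul_X w n hw =>
    have h : (φ ∘ₗ iota.toLinearMap) ∘ₗ create n =
        (φ ∘ₗ LinearMap.mulLeft QT (psum QT n)) ∘ₗ iota.toLinearMap := by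
      refine LinearMap.ext fun v => ?_
      simp [create, iota, fockIso_eq_aeval]
    rw [(shiftsBy_gammaPlus X).matrixElement_mul_X, h, hw, hw, map_mul,
      coproduct, MvPolynomial.aeval_X, contract_mul_coproduct_X]

/-- `F ⊗ G ↦ F(X) G(Y)`. -/
def sepHom : SymFun QT ⊗[QT] SymFun QT →ₐ[QT] MvPowerSeries (ℕ ⊕ ℕ) QT :=
  Algebra.TensorProduct.productMap (evalAtHom Function.Embedding.inl)
    (evalAtHom Function.Embedding.inr)

theorem sepHom_tmul (F G : SymFun QT) : sepHom (F ⊗ₜ G) =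
    evalAt F Function.Embedding.inl * evalAt G Function.Embedding.inr :=
  Algebra.TensorProduct.productMap_apply_tmul _ _ _ _

open Classical in
theorem coeff_evalAt_psum (X : ℕ ↪ σ) (n : ℕ+) (e : σ →₀ ℕ) :
    coeff e (evalAt (psum QT n) X) = if ∃ i, e = Finsupp.single (X i) (n : ℕ) then 1 else 0 := by
  by_cases he : e ∈ Set.range (Finsupp.embDomain X)
  · obtain ⟨d, rfl⟩ := he
    rw [evalAt, coeff_embDomain_rename, coeff_psum]
    simp_rw [shape_eq_singleton, ← Finsupp.embDomain_single,
      (Finsupp.embDomain_injective X).eq_iff]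
  · rw [evalAt, coeff_rename_eq_zero, if_neg]
    · rintro ⟨i, rfl⟩
      exact he ⟨Finsupp.single i (n : ℕ), Finsupp.embDomain_single _ _ _⟩
    · rintro ⟨d, rfl⟩
      exact he ⟨d, Finsupp.embDomain_eq_mapDomain _ _⟩

theorem evalTwo_psum (n : ℕ+) : evalTwo (psum QT n) =
    evalAt (psum QT n) Function.Embedding.inl + evalAt (psum QT n) Function.Embedding.inr := by
  classical
  have h : evalTwo (psum QT n) = evalAt (psum QT n) Equiv.natSumNatEquivNat.symm.toEmbedding := rfl
  ext1 e
  rw [h, map_add, coeff_evalAt_psum, coeff_evalAt_psum, coeff_evalAt_psum]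
  have hs : (∃ i, e = Finsupp.single (Equiv.natSumNatEquivNat.symm.toEmbedding i) (n : ℕ)) ↔
      (∃ i, e = Finsupp.single (Sum.inl i) (n : ℕ)) ∨ ∃ i, e = Finsupp.single (Sum.inr i) (n : ℕ) := by
    rw [← Sum.exists (p := fun j => e = Finsupp.single j (n : ℕ))]
    exact Equiv.natSumNatEquivNat.symm.surjective.exists
      (p := fun j => e = Finsupp.single j (n : ℕ)) |>.symm
  have hd : ¬ ((∃ i, e = Finsupp.single (Sum.inl i) (n : ℕ)) ∧
      ∃ i, e = Finsupp.single (Sum.inr i) (n : ℕ)) := by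
    rintro ⟨⟨i, rfl⟩, j, hj⟩
    have := DFunLike.congr_fun hj (Sum.inl i)
    simp at this
  rw [if_congr hs rfl rfl]
  change _ = (if ∃ i, e = Finsupp.single (Sum.inl i) (n : ℕ) then (1 : QT) else 0) +
    if ∃ i, e = Finsupp.single (Sum.inr i) (n : ℕ) then (1 : QT) else 0
  split_ifs <;> simp_all

/-- Both sides are algebra homomorphisms that agree on the power sums. -/
theorem evalTwo_iota (w : Fock) : evalTwo (iota w) = sepHom (coproduct w) := by
  let E : SymFun QT →ₐ[QT] MvPowerSeries (ℕ ⊕ ℕ) QT :=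
    (rename Equiv.natSumNatEquivNat.symm).comp (SymFun QT).val
  have h : E.comp (MvPolynomial.aeval (psum QT)) = sepHom.comp coproduct := by
    refine MvPolynomial.algHom_ext fun n => ?_
    rw [AlgHom.comp_apply E, AlgHom.comp_apply sepHom, MvPolynomial.aeval_X, coproduct,
      MvPolynomial.aeval_X, map_add, sepHom_tmul, sepHom_tmul, ← evalAtHom_apply _ 1,
      ← evalAtHom_apply _ 1, map_one, map_one, mul_one, one_mul, ← evalTwo_psum]
    rfl
  rw [iota, fockIso_eq_aeval]
  exact DFunLike.congr_fun h w

theorem coeff_evalAt_inl_mul_evalAt_inr (F G : SymFun QT) (a b : ℕ →₀ ℕ) :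
    coeff (a.embDomain Function.Embedding.inl + b.embDomain Function.Embedding.inr)
      (evalAt F Function.Embedding.inl * evalAt G Function.Embedding.inr) =
    coeff a F.1 * coeff b G.1 := by
  classical
  have hl : ∀ (d : ℕ →₀ ℕ) (i : ℕ),
      d.embDomain (Function.Embedding.inl : ℕ ↪ ℕ ⊕ ℕ) (Sum.inr i) = 0 := fun d i =>
    Finsupp.embDomain_of_notMem_range _ _ _ (by simp)
  have hr : ∀ (d : ℕ →₀ ℕ) (i : ℕ),
      d.embDomain (Function.Embedding.inr : ℕ ↪ ℕ ⊕ ℕ) (Sum.inl i) = 0 := fun d i =>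
    Finsupp.embDomain_of_notMem_range _ _ _ (by simp)
  have hl' : ∀ (d : ℕ →₀ ℕ) (i : ℕ),
      d.embDomain (Function.Embedding.inl : ℕ ↪ ℕ ⊕ ℕ) (Sum.inl i) = d i := fun d i =>
    Finsupp.embDomain_apply_self _ _ _
  have hr' : ∀ (d : ℕ →₀ ℕ) (i : ℕ),
      d.embDomain (Function.Embedding.inr : ℕ ↪ ℕ ⊕ ℕ) (Sum.inr i) = d i := fun d i =>
    Finsupp.embDomain_apply_self _ _ _
  rw [coeff_mul, Finset.sum_eq_single
    (a.embDomain Function.Embedding.inl, b.embDomain Function.Embedding.inr)]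
  · rw [evalAt, evalAt, coeff_embDomain_rename, coeff_embDomain_rename]
  · rintro ⟨x, y⟩ hxy hne
    by_contra h0
    have hx : ∃ d : ℕ →₀ ℕ, d.embDomain Function.Embedding.inl = x := by
      by_contra hx
      refine left_ne_zero_of_mul h0 (coeff_rename_eq_zero _ _ fun ⟨d, hd⟩ => hx ⟨d, ?_⟩)
      rw [Finsupp.embDomain_eq_mapDomain]; exact hd
    have hy : ∃ d : ℕ →₀ ℕ, d.embDomain Function.Embedding.inr = y := by
      by_contra hy
      refine right_ne_zero_of_mul h0 (coeff_rename_eq_zero _ _ fun ⟨d, hd⟩ => hy ⟨d, ?_⟩)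
      rw [Finsupp.embDomain_eq_mapDomain]; exact hd
    obtain ⟨d, rfl⟩ := hx
    obtain ⟨d', rfl⟩ := hy
    have h := Finset.HasAntidiagonal.mem_antidiagonal.1 hxy
    refine hne ?_
    have h1 : d = a := by
      ext i
      simpa [hl', hr] using DFunLike.congr_fun h (Sum.inl i)
    have h2 : d' = b := by
      ext i
      simpa [hl, hr'] using DFunLike.congr_fun h (Sum.inr i)
    rw [h1, h2]
  · intro h
    exact (h (Finset.HasAntidiagonal.mem_antidiagonal.2 rfl)).elim

theorem exists_eq_sum_tmul (b : Module.Basis Ptn QT (SymFun QT)) (z : SymFun QT ⊗[QT] SymFun QT) :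
    ∃ S : Ptn →₀ SymFun QT, z = S.sum fun m s => s ⊗ₜ b m := by
  refine ⟨TensorProduct.equivFinsuppOfBasisRight b z, ?_⟩
  rw [← TensorProduct.equivFinsuppOfBasisRight_symm_apply, LinearEquiv.symm_apply_apply]

/-- Comparing the coefficients of all monomials `x^a y^b`. -/
theorem sepHom_injective : Function.Injective sepHom := by
  classical
  rw [injective_iff_map_eq_zero]
  intro z hz
  obtain ⟨S, rfl⟩ := exists_eq_sum_tmul (psumBasis QT) z
  have hS : ∀ m (a : ℕ →₀ ℕ), coeff a (S m).1 = 0 := by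
    intro m a
    by_cases hm : m ∈ S.support
    · refine linearIndependent_iff'.1 (psumBasis QT).linearIndependent S.support
        (fun m => coeff a (S m).1) ?_ m hm
      refine Subtype.ext ?_
      ext1 b
      rw [AddSubmonoidClass.coe_finsetSum, map_sum]
      have h := congrArg (coeff (a.embDomain Function.Embedding.inl +
        b.embDomain Function.Embedding.inr)) hz
      rw [Finsupp.sum, map_sum, map_sum] at h
      simp only [sepHom_tmul, coeff_evalAt_inl_mul_evalAt_inr] at h
      rw [map_zero] at h
      exact h
    · rw [Finsupp.notMem_support_iff.1 hm]
      rfl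
  refine Finset.sum_eq_zero fun m _ => ?_
  have : S m = 0 := Subtype.ext (by ext1 a; exact hS m a)
  simp only [this, TensorProduct.zero_tmul]

/-- The skew expansion with respect to a basis `b` exists, is unique, and computes the action of
`Γ(X)_+`. It is unique because `F ⊗ G ↦ F(X) G(Y)` is injective. -/
theorem exists_skewCoeff (b : Module.Basis Ptn QT (SymFun QT)) (F : SymFun QT) :
    ∃ S : Ptn →₀ SymFun QT, (∀ m, skewCoeff b F m = S m) ∧
      ∀ {σ : Type} (X : ℕ ↪ σ) (φ : SymFun QT →ₗ[QT] QT),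
        matrixElement (φ ∘ₗ iota.toLinearMap) (iota.symm F) (gammaPlus X) =
          ∑ m ∈ S.support, φ (b m) • evalAt (S m) X := by
  -- A skew expansion is the same as an expansion of the coproduct, as `sepHom` is injective.
  have hsep : ∀ S : Ptn →₀ SymFun QT, IsSkewExpansion b F S ↔
      coproduct (iota.symm F) = S.sum fun m s => s ⊗ₜ b m := fun S => by
    rw [IsSkewExpansion, ← sepHom_injective.eq_iff, ← evalTwo_iota, LinearEquiv.apply_symm_apply,
      Finsupp.sum, Finsupp.sum, map_sum]
    simp only [sepHom_tmul]
  have hex : ∃ S, IsSkewExpansion b F S := by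
    obtain ⟨S, hS⟩ := exists_eq_sum_tmul b (coproduct (iota.symm F))
    exact ⟨S, (hsep S).2 hS⟩
  refine ⟨hex.choose, fun m => by rw [skewCoeff, dif_pos hex], fun X φ => ?_⟩
  rw [matrixElement_gammaPlus_eq_contract, (hsep _).1 hex.choose_spec, Finsupp.sum, map_sum]
  rfl

/-! ### Dual bases and the matrix elements of the process -/

theorem zeta_ne_zero (l : Ptn) : zeta l ≠ 0 := by
  rw [zeta]
  refine mul_ne_zero (Finset.prod_ne_zero_iff.2 fun i _ => mul_ne_zero
    (by exact_mod_cast Nat.factorial_ne_zero _) (pow_ne_zero _ (by exact_mod_cast i.ne_zero))) ?_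
  refine Multiset.prod_ne_zero fun h0 => ?_
  obtain ⟨i, -, hi⟩ := Multiset.mem_map.1 h0
  exact div_ne_zero (one_sub_q_pow_ne_zero i) (one_sub_t_pow_ne_zero i) hi

/-- The form is nondegenerate, and a basis vector that is orthogonal to all the others would
otherwise lie in its radical. -/
theorem innerQT_macP_self_ne_zero (l : Ptn) : innerQT (macP l) (macP l) ≠ 0 := by
  intro h0
  have h1 : innerQT (macP l) = 0 := macP.ext fun m => by
    by_cases h : l = m
    · rw [← h, h0, LinearMap.zero_apply]
    · rw [macP_orthogonal h, LinearMap.zero_apply]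
  have h2 : ∀ x : SymFun QT, ∀ m, innerQT x (psumPtn QT m) = zeta m * (psumBasis QT).repr x m := by
    intro x m
    have : innerQT.flip (psumPtn QT m) = zeta m • (psumBasis QT).coord m :=
      (psumBasis QT).ext fun k => by
        rw [LinearMap.flip_apply, psumBasis_apply, innerQT_psumPtn, ← psumBasis_apply,
          LinearMap.smul_apply, Module.Basis.coord_apply, Module.Basis.repr_self,
          Finsupp.single_apply, smul_eq_mul]
        by_cases h : k = m
        · simp [h]
        · simp [h]
    exact LinearMap.congr_fun this x
  refine macP.ne_zero l ((psumBasis QT).repr.map_eq_zero_iff.1 (Finsupp.ext fun m => ?_))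
  have h3 := h2 (macP l) m
  rw [h1, LinearMap.zero_apply, eq_comm, mul_eq_zero] at h3
  exact h3.resolve_left (zeta_ne_zero m)

/-- The basis `(Q_l)`, dual to `(P_l)`. -/
def macQBasis : Module.Basis Ptn QT (SymFun QT) :=
  macP.isUnitSMul fun l => (inv_ne_zero (innerQT_macP_self_ne_zero l)).isUnit

theorem coe_macQBasis : (macQBasis : Ptn → SymFun QT) = macQ := by
  funext l
  rw [macQBasis, Module.Basis.isUnitSMul_apply, macQ]

theorem innerQT_macP_macQ (l m : Ptn) : innerQT (macP l) (macQ m) = if l = m then 1 else 0 := by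
  rw [macQ, map_smul, smul_eq_mul]
  split_ifs with h
  · rw [h, inv_mul_cancel₀ (innerQT_macP_self_ne_zero m)]
  · rw [macP_orthogonal h, mul_zero]

theorem innerQT_macQ_macP (l m : Ptn) : innerQT (macQ l) (macP m) = if l = m then 1 else 0 := by
  rw [macQ, map_smul, LinearMap.smul_apply, smul_eq_mul]
  split_ifs with h
  · rw [h, inv_mul_cancel₀ (innerQT_macP_self_ne_zero m)]
  · rw [macP_orthogonal h, mul_zero]

theorem pairing_iota_symm (F : SymFun QT) :
    pairing (iotaDual.symm F) = innerQT F ∘ₗ iota.toLinearMap := by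
  refine LinearMap.ext fun w => ?_
  rw [pairing_eq_innerQT, LinearEquiv.apply_symm_apply]
  rfl

theorem pairing_ketP_braQ (l m : Ptn) : pairing (ketP l) (braQ m) = if l = m then 1 else 0 := by
  rw [← innerQT_macP_macQ, pairing_eq_innerQT]
  change innerQT (iota (iota.symm (macP l))) (iota (iota.symm (macQ m))) = _
  rw [LinearEquiv.apply_symm_apply, LinearEquiv.apply_symm_apply]

/-- `Γ(X)_+|Q_l⟩ = ∑ v, Q_{l/v}(X) |Q_v⟩`, a finite sum. -/
theorem exists_skewQ (l : Ptn) : ∃ s : Finset Ptn, (∀ v ∉ s, skewQ l v = 0) ∧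
    ∀ {σ : Type} (X : ℕ ↪ σ) (φ : Fock →ₗ[QT] QT),
      matrixElement φ (braQ l) (gammaPlus X) = ∑ v ∈ s, φ (braQ v) • evalAt (skewQ l v) X := by
  obtain ⟨S, hS, h⟩ := exists_skewCoeff macQBasis (macQ l)
  rw [coe_macQBasis] at hS h
  refine ⟨S.support, fun v hv => ?_, fun X φ => ?_⟩
  · rw [skewQ, hS, Finsupp.notMem_support_iff.1 hv]
  · have := h X (φ ∘ₗ iota.symm.toLinearMap)
    rw [LinearMap.comp_assoc, LinearEquiv.comp_coe, LinearEquiv.self_trans_symm,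
      LinearEquiv.refl_toLinearMap, LinearMap.comp_id] at this
    simp_rw [skewQ, hS]
    exact this

/-- `⟨Q_v|Γ(X)_+|P_l⟩ = P_{l/v}(X)`. -/
theorem matrixElement_ketP_gammaPlus (l v : Ptn) (X : ℕ ↪ σ) :
    matrixElement (pairing (braQ v)) (ketP l) (gammaPlus X) = evalAt (skewP l v) X := by
  obtain ⟨S, hS, h⟩ := exists_skewCoeff macP (macP l)
  rw [braQ, pairing_iota_symm, ketP, h, skewP, hS]
  simp_rw [innerQT_macQ_macP, ite_smul, one_smul, zero_smul, Finset.sum_ite_eq]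
  split_ifs with hv
  · rfl
  · rw [Finsupp.notMem_support_iff.1 hv, ← evalAtHom_apply, map_zero]

/-- A finite expansion `T|w⟩ = ∑ i, r_i |u_i⟩` may be multiplied from the left by an operator. -/
theorem matrixElement_mul_of_expansion {T : OpSeries σ} {w : Fock} {ι : Type*} {s : Finset ι}
    {u : ι → Fock} {r : ι → MvPowerSeries σ QT}
    (h : ∀ φ : Fock →ₗ[QT] QT, matrixElement φ w T = ∑ i ∈ s, φ (u i) • r i)
    (S : OpSeries σ) (φ : Fock →ₗ[QT] QT) :
    matrixElement φ w (S * T) = ∑ i ∈ s, r i * matrixElement φ (u i) S := by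
  classical
  ext1 e
  rw [coeff_matrixElement, coeff_mul, LinearMap.sum_apply, map_sum, map_sum]
  simp_rw [mul_comm (r _), coeff_mul]
  rw [Finset.sum_comm]
  refine Finset.sum_congr rfl fun x _ => ?_
  have := congrArg (coeff x.2) (h (φ ∘ₗ coeff x.1 S))
  rw [coeff_matrixElement, map_sum] at this
  exact this

/-- `⟨P_m|Γ(X)_- Γ(Y)_+|Q_l⟩ = Ψ_{l,m}(Y, X)`. -/
theorem transition_eq_matrixElement (l m : Ptn) (Y X : ℕ ↪ σ) :
    FormallySummable (transitionTerm l m Y X) ∧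
    transition l m Y X =
      matrixElement (pairing (ketP m)) (braQ l) (gammaMinus X * gammaPlus Y) := by
  obtain ⟨s, hs0, hs⟩ := exists_skewQ l
  have hzero : ∀ v ∉ s, transitionTerm l m Y X v = 0 := fun v hv => by
    rw [transitionTerm, hs0 v hv, ← evalAtHom_apply, map_zero, zero_mul]
  have hsub : ∀ e, (Function.support fun v => coeff e (transitionTerm l m Y X v)) ⊆ s :=
    fun e v hv => by
      by_contra hvs
      exact hv ((congrArg (coeff e) (hzero v hvs)).trans (map_zero _))
  refine ⟨fun e => s.finite_toSet.subset (hsub e), ?_⟩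
  rw [matrixElement_mul_of_expansion (hs Y)]
  ext1 e
  rw [map_sum]
  refine (finsum_eq_sum_of_support_subset _ (hsub e)).trans (Finset.sum_congr rfl fun v _ => ?_)
  rw [(isAdjoint_gamma X).matrixElement, matrixElement_ketP_gammaPlus, transitionTerm]

/-! ### Formally summable families -/

section
variable {σ ι κ A : Type*} [Semiring A]

theorem FormallySummable.mul_left {d : κ → MvPowerSeries σ A} (hd : FormallySummable d)
    (g : MvPowerSeries σ A) : FormallySummable fun k => g * d k := by
  classical
  intro e
  refine ((Finset.HasAntidiagonal.antidiagonal e).finite_toSet.biUnion fun x _ => hd x.2).subset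
    fun k hk => ?_
  rw [Function.mem_support, coeff_mul] at hk
  obtain ⟨x, hx, hne⟩ := Finset.exists_ne_zero_of_sum_ne_zero hk
  exact Set.mem_biUnion hx (right_ne_zero_of_mul hne)

theorem formalSum_mul_left {d : κ → MvPowerSeries σ A} (hd : FormallySummable d)
    (g : MvPowerSeries σ A) : formalSum (fun k => g * d k) = g * formalSum d := by
  classical
  ext1 e
  change ∑ᶠ k, coeff e (g * d k) = _
  simp_rw [coeff_mul]
  rw [finsum_sum_comm]
  · exact Finset.sum_congr rfl fun x _ => (mul_finsum' _ _ (hd x.2)).symm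
  · exact fun x _ => (hd x.2).subset fun k hk => right_ne_zero_of_mul hk

theorem FormallySummable.prod {c : ι → MvPowerSeries σ A} {d : ι → κ → MvPowerSeries σ A}
    (hc : FormallySummable c) (hd : ∀ i, FormallySummable (d i)) :
    FormallySummable fun p : ι × κ => c p.1 * d p.1 p.2 := by
  classical
  intro e
  refine ((Finset.HasAntidiagonal.antidiagonal e).finite_toSet.biUnion fun x _ =>
    (hc x.1).biUnion fun i _ => (hd i x.2).image (Prod.mk i)).subset ?_
  rintro ⟨i, k⟩ hk
  rw [Function.mem_support, coeff_mul] at hk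
  obtain ⟨x, hx, hne⟩ := Finset.exists_ne_zero_of_sum_ne_zero hk
  exact Set.mem_biUnion hx (Set.mem_biUnion (left_ne_zero_of_mul hne)
    ⟨k, right_ne_zero_of_mul hne, rfl⟩)

theorem formalSum_prod {c : ι → MvPowerSeries σ A} {d : ι → κ → MvPowerSeries σ A}
    (hc : FormallySummable c) (hd : ∀ i, FormallySummable (d i)) :
    formalSum (fun p : ι × κ => c p.1 * d p.1 p.2) = formalSum fun i => c i * formalSum (d i) := by
  ext1 e
  change ∑ᶠ p : ι × κ, coeff e (c p.1 * d p.1 p.2) = ∑ᶠ i, coeff e (c i * formalSum (d i))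
  rw [finsum_curry _ (hc.prod hd e)]
  refine finsum_congr fun i => ?_
  rw [← formalSum_mul_left (hd i)]
  rfl

theorem FormallySummable.of_equiv (E : κ ≃ ι) {d : ι → MvPowerSeries σ A}
    (h : FormallySummable (d ∘ E)) : FormallySummable d := fun e => by
  refine ((h e).image E).subset fun i hi => ⟨E.symm i, ?_, E.apply_symm_apply i⟩
  simpa using hi

theorem formalSum_comp_equiv (E : κ ≃ ι) (d : ι → MvPowerSeries σ A) :
    formalSum (d ∘ E) = formalSum d := by
  ext1 e
  exact finsum_comp_equiv E (f := fun i => coeff e (d i))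

end

/-! ### Insertion of a diagonal operator -/

/-- `|P_l⟩⟨Q_l| = |Q_l⟩⟨P_l|`. -/
theorem pairing_braQ_smul_ketP (l : Ptn) (v : Fock) :
    pairing (braQ l) v • ketP l = pairing (ketP l) v • braQ l := by
  have h : braQ l = (innerQT (macP l) (macP l))⁻¹ • ketP l := by
    rw [braQ, ketP, macQ]
    exact map_smul iota.symm _ _
  rw [h, map_smul, LinearMap.smul_apply, smul_eq_mul, mul_comm, mul_smul]

theorem ketP_support_finite (v : Fock) : {l : Ptn | pairing (ketP l) v ≠ 0}.Finite := by
  refine (braQ_support_finite v).subset fun l hl h0 => hl ?_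
  have h := pairing_braQ_smul_ketP l v
  rw [h0, zero_smul] at h
  refine (smul_eq_zero.1 h.symm).resolve_right fun hb => ?_
  have := pairing_ketP_braQ l l
  rw [hb, map_zero, if_pos rfl] at this
  exact zero_ne_one this

theorem diagOp_eq_sum (f : Ptn → QT) (v : Fock) {s : Finset Ptn}
    (hs : ∀ l ∉ s, pairing (ketP l) v = 0) :
    diagOp f v = ∑ l ∈ s, f l • pairing (ketP l) v • braQ l := by
  change ∑ᶠ l : Ptn, f l • pairing (braQ l) v • ketP l = _
  simp_rw [pairing_braQ_smul_ketP]
  refine finsum_eq_sum_of_support_subset _ fun l hl => ?_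
  by_contra h
  exact hl (by simp only [hs l h, zero_smul, smul_zero])

/-- The resolution of the identity `∑ l, |P_l⟩⟨Q_l| = 1`. -/
theorem diagOp_one : diagOp (fun _ => 1) = 1 := by
  refine LinearMap.ext fun v => ?_
  have hv : v = ∑ l ∈ (macQBasis.repr (iota v)).support, macQBasis.repr (iota v) l • braQ l := by
    apply iota.injective
    conv_lhs => rw [← macQBasis.linearCombination_repr (iota v), coe_macQBasis]
    rw [map_sum]
    refine Finset.sum_congr rfl fun l _ => ?_
    rw [map_smul]
    change _ = _ • iota (iota.symm (macQ l))
    rw [LinearEquiv.apply_symm_apply]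
    rfl
  have hl : ∀ l, pairing (ketP l) v = macQBasis.repr (iota v) l := fun l => by
    conv_lhs => rw [hv, map_sum]
    simp_rw [map_smul, pairing_ketP_braQ, smul_eq_mul, mul_ite, mul_one, mul_zero,
      Finset.sum_ite_eq]
    split_ifs with h
    · rfl
    · rw [Finsupp.notMem_support_iff.1 h]
  rw [diagOp_eq_sum _ v (s := (macQBasis.repr (iota v)).support)]
  · simp_rw [one_smul, hl]
    exact hv.symm
  · intro l h
    rw [hl, Finsupp.notMem_support_iff.1 h]

/-- `⟨φ|S O(f) T|w⟩ = ∑ l, f(l) ⟨P_l|T|w⟩ ⟨φ|S|Q_l⟩`. The sum is formally finite for every `f`, since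
each of the finitely many coefficients of `T|w⟩` involved is orthogonal to almost all `P_l`. -/
theorem matrixElement_mul_diagOp_mul (f : Ptn → QT) (φ : Fock →ₗ[QT] QT) (w : Fock)
    (S T : OpSeries σ) :
    FormallySummable (fun l => (f l • matrixElement (pairing (ketP l)) w T) *
      matrixElement φ (braQ l) S) ∧
    matrixElement φ w (S * C (diagOp f) * T) =
      formalSum fun l => (f l • matrixElement (pairing (ketP l)) w T) *
        matrixElement φ (braQ l) S := by
  classical
  -- For a fixed monomial only finitely many vectors `coeff x.2 T w` occur, so one finite set of
  -- partitions serves for all of them.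
  have key : ∀ e : σ →₀ ℕ, ∃ s : Finset Ptn,
      ∀ x ∈ Finset.HasAntidiagonal.antidiagonal e, ∀ l ∉ s, pairing (ketP l) (coeff x.2 T w) = 0 :=
    fun e => ⟨(Finset.HasAntidiagonal.antidiagonal e).biUnion fun x =>
      (ketP_support_finite (coeff x.2 T w)).toFinset, fun x hx l hl => by
        by_contra h
        exact hl (Finset.mem_biUnion.2 ⟨x, hx, (Set.Finite.mem_toFinset _).2 h⟩)⟩
  have hcoeff : ∀ e l, coeff e ((f l • matrixElement (pairing (ketP l)) w T) *
      matrixElement φ (braQ l) S) = ∑ x ∈ Finset.HasAntidiagonal.antidiagonal e,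
        φ (coeff x.1 S (f l • pairing (ketP l) (coeff x.2 T w) • braQ l)) := fun e l => by
    rw [mul_comm, coeff_mul]
    refine Finset.sum_congr rfl fun x _ => ?_
    rw [coeff_smul, coeff_matrixElement, coeff_matrixElement]
    simp only [map_smul, smul_eq_mul]
    ring
  have hsub : ∀ e (s : Finset Ptn), (∀ x ∈ Finset.HasAntidiagonal.antidiagonal e,
      ∀ l ∉ s, pairing (ketP l) (coeff x.2 T w) = 0) →
      (Function.support fun l => coeff e ((f l • matrixElement (pairing (ketP l)) w T) *
        matrixElement φ (braQ l) S)) ⊆ s := fun e s hs l hl => by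
    by_contra h
    refine hl ((hcoeff e l).trans (Finset.sum_eq_zero fun x hx => ?_))
    rw [hs x hx l h, zero_smul, smul_zero, map_zero, map_zero]
  constructor
  · intro e
    obtain ⟨s, hs⟩ := key e
    exact s.finite_toSet.subset (hsub e s hs)
  · ext1 e
    obtain ⟨s, hs⟩ := key e
    refine Eq.trans ?_ (finsum_eq_sum_of_support_subset _ (hsub e s hs)).symm
    simp_rw [hcoeff]
    rw [Finset.sum_comm, coeff_matrixElement, coeff_mul, LinearMap.sum_apply, map_sum]
    refine Finset.sum_congr rfl fun x hx => ?_
    rw [coeff_mul_C, Module.End.mul_apply, Module.End.mul_apply, diagOp_eq_sum f _ (hs x hx),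
      map_sum, map_sum]

/-! ### The commutation of the two vertex operators -/

/-- `Π(X, Y) = ⟨0|Γ(Y)_+ Γ(X)_-|0⟩`. -/
theorem cauchyTerm_eq_matrixElement (X Y : ℕ ↪ σ) : FormallySummable (cauchyTerm X Y) ∧
    cauchyPi X Y = matrixElement (pairing 1) 1 (gammaPlus Y * gammaMinus X) := by
  have h := matrixElement_mul_diagOp_mul (fun _ => 1) (pairing 1) 1 (gammaPlus Y) (gammaMinus X)
  have hc : (fun l => ((1 : QT) • matrixElement (pairing (ketP l)) 1 (gammaMinus X)) *
      matrixElement (pairing 1) (braQ l) (gammaPlus Y)) = cauchyTerm X Y := by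
    funext l
    rw [one_smul, matrixElement_one_gammaMinus, matrixElement_pairing_one_gammaPlus, cauchyTerm,
      ketP, LinearEquiv.apply_symm_apply]
    congr 2
    exact iota.apply_symm_apply _
  rw [hc, diagOp_one, map_one (C (σ := σ) (R := Module.End QT Fock)), mul_one] at h
  exact ⟨h.1, h.2.symm⟩

theorem constantCoeff_cauchyPi (X Y : ℕ ↪ σ) : constantCoeff (cauchyPi X Y) = 1 := by
  rw [(cauchyTerm_eq_matrixElement X Y).2, ← coeff_zero_eq_constantCoeff_apply,
    coeff_matrixElement, coeff_zero_eq_constantCoeff_apply, map_mul,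
    ← coeff_zero_eq_constantCoeff_apply, ← coeff_zero_eq_constantCoeff_apply, gammaPlus, gammaMinus,
    coeff_zero_formalExp (constantCoeff_vertexExponent _ _),
    coeff_zero_formalExp (constantCoeff_vertexExponent _ _), mul_one, Module.End.one_apply,
    pairing_vacuum]

theorem gammaPlus_comm (X Y : ℕ ↪ σ) : gammaPlus X * gammaPlus Y = gammaPlus Y * gammaPlus X := by
  have h1 := (shiftsBy_gammaPlus X).mul (shiftsBy_gammaPlus Y)
  have h2 := (shiftsBy_gammaPlus Y).mul (shiftsBy_gammaPlus X)
  rw [add_comm] at h2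
  refine h1.ext h2 fun φ => ?_
  rw [matrixElement_mul_gammaPlus_one, matrixElement_mul_gammaPlus_one,
    ← one_mul (gammaPlus X), ← one_mul (gammaPlus Y), matrixElement_mul_gammaPlus_one,
    matrixElement_mul_gammaPlus_one]

/-- The pairing is nondegenerate: a vector orthogonal to all `|P_l⟩` is killed by `O(1) = 1`. -/
theorem eq_of_forall_pairing_eq {u w : Fock} (h : ∀ v, pairing v u = pairing v w) : u = w := by
  rw [← sub_eq_zero]
  have h1 := diagOp_eq_sum (fun _ => 1) (u - w) (s := ∅) fun l _ => by
    rw [map_sub, h, sub_self]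
  rwa [diagOp_one, Finset.sum_empty] at h1

/-- `Γ(Y)_+ Γ(X)_- = Π(X, Y) Γ(X)_- Γ(Y)_+`. Both sides shift `a_{-n}` by `p_n(Y)`. On the vacuum,
taking adjoints reduces the matrix elements with `⟨v|` to `v(X)` times those with `⟨0|`. -/
theorem gammaPlus_mul_gammaMinus (X Y : ℕ ↪ σ) :
    gammaPlus Y * gammaMinus X = scalarSeries (cauchyPi X Y) * (gammaMinus X * gammaPlus Y) := by
  have h1 := (shiftsBy_gammaPlus Y).mul (shiftsBy_gammaMinus X)
  have h2 := ((shiftsBy_gammaMinus X).mul (shiftsBy_gammaPlus Y)).scalarSeries_mul (cauchyPi X Y)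
  rw [add_comm] at h2
  have hv : ∀ v, matrixElement (pairing v) 1 (gammaPlus Y * gammaMinus X) =
      matrixElement (pairing v) 1 (scalarSeries (cauchyPi X Y) * (gammaMinus X * gammaPlus Y)) := by
    intro v
    have h3 := (shiftsBy_gammaPlus X).mul (shiftsBy_gammaMinus Y)
    have h4 := (shiftsBy_gammaMinus Y).mul (shiftsBy_gammaPlus X)
    rw [add_comm] at h4
    have a1 := (isAdjoint_gamma Y).symm.mul (isAdjoint_gamma X)
    have a2 := (isAdjoint_gamma X).mul (isAdjoint_gamma Y).symm
    rw [matrixElement_scalarSeries_mul, a1.matrixElement, a2.matrixElement,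
      h3.matrixElement_pairing_one, h4.matrixElement_pairing_one, matrixElement_gammaMinus_mul,
      matrixElement_pairing_one_gammaPlus, ← a1.matrixElement, (cauchyTerm_eq_matrixElement X Y).2]
    have : evalAt (iota 1) X = 1 := by
      rw [iota, fockIso_eq_aeval, map_one, ← evalAtHom_apply, map_one]
    rw [this]
    ring
  refine h1.ext h2 fun φ => ?_
  ext1 e
  exact congrArg φ (eq_of_forall_pairing_eq fun v => congrArg (coeff e) (hv v))

/-! ### Several steps -/

/-- `ψ_{f_N} ... ψ_{f_1}` for arbitrary sets of variables, which need not be disjoint. This lets steps be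
split off without changing the ambient variables. -/
def psiSeq {N : ℕ} (f : Fin N → Ptn → QT) (X Y : Fin N → ℕ ↪ σ) : OpSeries σ :=
  (List.ofFn fun i => psi (f i) (X i) (Y i)).reverse.prod

/-- The summand `f_1(l_1) ... f_N(l_N)` times
`⟨P_{l_1}|Γ(X^(1))_- T|w⟩ Ψ_{l_1,l_2} ... Ψ_{l_{N-1},l_N} ⟨φ|Γ(Y^(N))_+|Q_{l_N}⟩`. It is the numerator
of the process if `φ = ⟨0|`, `w = |0⟩` and `T = 1`. -/
def stepTerm {n : ℕ} (f : Fin (n + 1) → Ptn → QT) (X Y : Fin (n + 1) → ℕ ↪ σ)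
    (φ : Fock →ₗ[QT] QT) (w : Fock) (T : OpSeries σ) (l : Fin (n + 1) → Ptn) :
    MvPowerSeries σ QT :=
  (∏ i, f i (l i)) • (matrixElement (pairing (ketP (l 0))) w (gammaMinus (X 0) * T) *
    (∏ i : Fin n, transition (l i.castSucc) (l i.succ) (Y i.castSucc) (X i.succ)) *
    matrixElement φ (braQ (l (Fin.last n))) (gammaPlus (Y (Fin.last n))))

/-- `⟨φ|ψ_{f_N} ... ψ_{f_1} T|w⟩` as a sum over sequences of partitions. In the induction the first step
is split off by inserting `O(f_1)`; its `Γ(Y^(1))_+` becomes the new `T`, and `|Q_{l_1}⟩` the new `w`. -/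
theorem matrixElement_psiSeq_mul (n : ℕ) : ∀ (f : Fin (n + 1) → Ptn → QT)
    (X Y : Fin (n + 1) → ℕ ↪ σ) (φ : Fock →ₗ[QT] QT) (w : Fock) (T : OpSeries σ),
    FormallySummable (stepTerm f X Y φ w T) ∧
    matrixElement φ w (psiSeq f X Y * T) = formalSum (stepTerm f X Y φ w T) := by
  induction n with
  | zero =>
    intro f X Y φ w T
    have h := matrixElement_mul_diagOp_mul (f 0) φ w (gammaPlus (Y 0)) (gammaMinus (X 0) * T)
    have hE : stepTerm f X Y φ w T ∘ (Equiv.funUnique (Fin 1) Ptn).symm = fun l =>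
        (f 0 l • matrixElement (pairing (ketP l)) w (gammaMinus (X 0) * T)) *
          matrixElement φ (braQ l) (gammaPlus (Y 0)) := by
      funext l
      simp [stepTerm]
    have hp : psiSeq f X Y * T = gammaPlus (Y 0) * C (diagOp (f 0)) * (gammaMinus (X 0) * T) := by
      simp [psiSeq, psi, mul_assoc]
    rw [← hE] at h
    rw [hp, h.2, formalSum_comp_equiv]
    exact ⟨h.1.of_equiv _, rfl⟩
  | succ n ih =>
    intro f X Y φ w T
    let f' : Fin (n + 1) → Ptn → QT := fun i => f i.succ
    let X' : Fin (n + 1) → ℕ ↪ σ := fun i => X i.succ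
    let Y' : Fin (n + 1) → ℕ ↪ σ := fun i => Y i.succ
    have hp : psiSeq f X Y * T = (psiSeq f' X' Y' * gammaPlus (Y 0)) * C (diagOp (f 0)) *
        (gammaMinus (X 0) * T) := by
      simp [psiSeq, psi, mul_assoc, f', X', Y', List.ofFn_succ]
    let c : Ptn → MvPowerSeries σ QT := fun m =>
      f 0 m • matrixElement (pairing (ketP m)) w (gammaMinus (X 0) * T)
    let d : Ptn → (Fin (n + 1) → Ptn) → MvPowerSeries σ QT := fun m =>
      stepTerm f' X' Y' φ (braQ m) (gammaPlus (Y 0))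
    have hc : FormallySummable c := fun e =>
      (ketP_support_finite (coeff e (gammaMinus (X 0) * T) w)).subset fun m hm h0 => hm (by
        simp only [c, coeff_smul, coeff_matrixElement, h0, mul_zero])
    have hd : ∀ m, FormallySummable (d m) := fun m => (ih f' X' Y' φ (braQ m) _).1
    have hE : stepTerm f X Y φ w T ∘ Fin.consEquiv (fun _ : Fin (n + 2) => Ptn) =
        fun p => c p.1 * d p.1 p.2 := by
      funext p
      obtain ⟨m, l⟩ := p
      have hprod : ∏ i : Fin (n + 1), transition ((Fin.cons m l : Fin (n + 2) → Ptn) i.castSucc)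
          ((Fin.cons m l : Fin (n + 2) → Ptn) i.succ) (Y i.castSucc) (X i.succ) =
          transition m (l 0) (Y 0) (X (Fin.succ 0)) *
            ∏ i : Fin n, transition (l i.castSucc) (l i.succ) (Y' i.castSucc) (X' i.succ) := by
        rw [Fin.prod_univ_succ]
        simp only [← Fin.succ_castSucc, Fin.cons_succ]
        rfl
      simp only [Function.comp, Fin.consEquiv_apply, stepTerm, c, d]
      rw [hprod, Fin.prod_univ_succ (n := n + 1),
        ← (transition_eq_matrixElement m (l 0) (Y 0) (X' 0)).2]
      simp only [Fin.cons_zero, Fin.cons_succ, ← Fin.succ_last, f', X', Y']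
      rw [smul_mul_smul_comm]
      congr 1
      ring
    have h := matrixElement_mul_diagOp_mul (f 0) φ w (psiSeq f' X' Y' * gammaPlus (Y 0))
      (gammaMinus (X 0) * T)
    have hsum := (hc.prod hd)
    rw [← hE] at hsum
    refine ⟨hsum.of_equiv _, ?_⟩
    rw [hp, h.2, ← formalSum_comp_equiv (Fin.consEquiv (fun _ : Fin (n + 2) => Ptn)), hE,
      formalSum_prod hc hd]
    simp_rw [fun m => (ih f' X' Y' φ (braQ m) (gammaPlus (Y 0))).2]
    rfl

/-- Moving `Γ(Z)_+` through all the steps costs a factor `Π(X^(i), Z)` for each of them. -/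
theorem gammaPlus_mul_psiSeq_one (Z : ℕ ↪ σ) (N : ℕ) : ∀ X Y : Fin N → ℕ ↪ σ,
    gammaPlus Z * psiSeq (fun _ _ => 1) X Y =
      scalarSeries (∏ i, cauchyPi (X i) Z) * (psiSeq (fun _ _ => 1) X Y * gammaPlus Z) := by
  induction N with
  | zero => intro X Y; simp [psiSeq]
  | succ N ih =>
    intro X Y
    have hp : psiSeq (fun _ _ => 1) X Y = psiSeq (fun _ _ => 1) (fun i : Fin N => X i.succ)
        (fun i => Y i.succ) * (gammaPlus (Y 0) * gammaMinus (X 0)) := by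
      simp [psiSeq, psi, List.ofFn_succ, diagOp_one]
    rw [hp, ← mul_assoc, ih, Fin.prod_univ_succ, map_mul]
    have h1 : gammaPlus Z * (gammaPlus (Y 0) * gammaMinus (X 0)) =
        scalarSeries (cauchyPi (X 0) Z) * (gammaPlus (Y 0) * gammaMinus (X 0) * gammaPlus Z) := by
      rw [← mul_assoc, gammaPlus_comm, mul_assoc, gammaPlus_mul_gammaMinus, ← mul_assoc,
        ← (scalarSeries_commute _ _).eq]
      simp only [mul_assoc]
    rw [mul_assoc, mul_assoc (psiSeq _ _ _), h1, ← mul_assoc (psiSeq _ _ _),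
      ← (scalarSeries_commute _ (psiSeq _ _ _)).eq]
    rw [← mul_assoc, ← mul_assoc, (scalarSeries_commute (cauchyPi (X 0) Z) (scalarSeries _)).eq]
    simp only [mul_assoc]

/-- The denominator `⟨0|ψ_1 ... ψ_1|0⟩`; the last step contributes the factors with `j = N`. -/
theorem vev_psiSeq_one (N : ℕ) : ∀ X Y : Fin N → ℕ ↪ σ,
    matrixElement (pairing 1) 1 (psiSeq (fun _ _ => 1) X Y) =
      ∏ i, ∏ j ∈ Finset.Ici i, cauchyPi (X i) (Y j) := by
  induction N with
  | zero => intro X Y; simp [psiSeq, matrixElement_one, pairing_vacuum]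
  | succ N ih =>
    intro X Y
    have hp : psiSeq (fun _ _ => 1) X Y = gammaPlus (Y (Fin.last N)) * gammaMinus (X (Fin.last N)) *
        psiSeq (fun _ _ => 1) (fun i : Fin N => X i.castSucc) (fun i => Y i.castSucc) := by
      simp only [psiSeq]
      rw [List.ofFn_succ']
      simp [psi, diagOp_one]
    have hI : ∀ {M : ℕ} (i : Fin M) (g : Fin M → MvPowerSeries σ QT),
        ∏ j ∈ Finset.Ici i, g j = ∏ j, if i ≤ j then g j else 1 := fun i g => by
      rw [← Finset.prod_filter]; congr 1; ext j; simp
    rw [hp, gammaPlus_mul_gammaMinus, mul_assoc, mul_assoc, gammaPlus_mul_psiSeq_one,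
      matrixElement_scalarSeries_mul, matrixElement_gammaMinus_mul, matrixElement_scalarSeries_mul,
      matrixElement_mul_gammaPlus_one, ih]
    simp only [hI]
    rw [Fin.prod_univ_castSucc]
    simp only [Fin.prod_univ_castSucc, Fin.castSucc_le_castSucc_iff, Fin.le_last, if_true,
      Finset.prod_mul_distrib]
    have h0 : ∏ j : Fin N, (if Fin.last N ≤ j.castSucc then
        cauchyPi (X (Fin.last N)) (Y j.castSucc) else 1) = 1 :=
      Finset.prod_eq_one fun j _ => if_neg (not_le.2 (Fin.castSucc_lt_last j))
    rw [h0]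
    ring

end
end MacFock

open MacFock in
theorem theorem1p1 (n : ℕ) (f : Fin (n + 1) → MacFock.Ptn → MacFock.QT) :
    (∀ i j : Fin (n + 1), i ≤ j →
      MacFock.FormallySummable (MacFock.cauchyTerm (MacFock.alphX i) (MacFock.alphY j))) ∧
    IsUnit (MacFock.normalization (n + 1)) ∧
    (∀ (i : Fin n) (l m : MacFock.Ptn), MacFock.FormallySummable
      (MacFock.transitionTerm l m (MacFock.alphY i.castSucc) (MacFock.alphX i.succ))) ∧
    MacFock.FormallySummable (MacFock.correlationTerm f) ∧
    IsUnit (MacFock.vev (MacFock.psiProduct fun (_ : Fin (n + 1)) (_ : MacFock.Ptn) =>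
      (1 : MacFock.QT))) ∧
    MacFock.correlation f =
      MacFock.vev (MacFock.psiProduct f) *
        (MacFock.vev (MacFock.psiProduct fun (_ : Fin (n + 1)) (_ : MacFock.Ptn) =>
          (1 : MacFock.QT)))⁻¹ := by
  have hone : vev (psiProduct fun (_ : Fin (n + 1)) (_ : Ptn) => (1 : QT)) =
      normalization (n + 1) := vev_psiSeq_one (n + 1) alphX alphY
  have hunit : IsUnit (normalization (n + 1)) := by
    rw [MvPowerSeries.isUnit_iff_constantCoeff, normalization, map_prod]
    simp [map_prod, constantCoeff_cauchyPi]
  obtain ⟨hs, hsum⟩ := matrixElement_psiSeq_mul n f alphX alphY (pairing 1) 1 1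
  have hterm : (fun l => (normalization (n + 1))⁻¹ * stepTerm f alphX alphY (pairing 1) 1 1 l) =
      correlationTerm f := by
    funext l
    rw [stepTerm, mul_one, matrixElement_one_gammaMinus, matrixElement_pairing_one_gammaPlus,
      correlationTerm, macdonaldProcess, processWeight, mul_smul_comm, mul_comm, ketP,
      LinearEquiv.apply_symm_apply]
    congr 4
    exact iota.apply_symm_apply _
  have hvev : vev (psiProduct f) = formalSum (stepTerm f alphX alphY (pairing 1) 1 1) := by
    rw [← hsum, mul_one]; rfl
  refine ⟨fun i j _ => (cauchyTerm_eq_matrixElement _ _).1, hunit,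
    fun i l m => (transition_eq_matrixElement _ _ _ _).1, ?_, hone ▸ hunit, ?_⟩
  · rw [← hterm]
    exact hs.mul_left _
  · rw [hone, correlation, ← hterm, formalSum_mul_left hs, hvev, mul_comm]
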